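/- Let $T>0$, let $\alpha_0>\alpha_1>\dots>\alpha_m\ge 0$ be real numbers and let $n_i$ be the nonnegative integer with $n_i-1<\alpha_i\le n_i$. For $0\le\gamma<1$ let $C_\gamma[0,T]$ be the space of functions $f$ on $(0,T]$ such that $t^\gamma f(t)$ extends to a continuous function on $[0,T]$ (so that $C_0[0,T]=C[0,T]$). For $n\ge 1$ let $C_\gamma^n[0,T]$ be the space of functions that are $n-1$ times continuously differentiable on $[0,T]$ and have an $n$-th derivative on $(0,T]$ that lies in $C_\gamma[0,T]$, with the norm $\sum_{k<n}\sup_{[0,T]}|f^{(k)}|+\sup_{(0,T]}|t^\gamma f^{(n)}(t)|$. Put $I_{0+}^{\alpha}f(t)=\frac1{\Gamma(\alpha)}\int_0^t(t-\tau)^{\alpha-1}f(\tau)\,d\tau$ for $\alpha>0$ and $I_{0+}^0f=f$; for $n-1<\alpha\le n$ put $D_{0+}^\alpha f=\frac{d^n}{dt^n}I_{0+}^{n-\alpha}f$ and ${}^cD_{0+}^\alpha f=D_{0+}^\alpha\bigl[f(t)-\sum_{k=0}^{n-1}\frac{f^{(k)}(0)}{k!}t^k\bigr]$. Put $\Phi_\beta(t)=t^{\beta-1}/\Gamma(\beta)$,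 $H_j=\{i: 1\le i\le m,\ 0\le\alpha_i\le j\}$ and, if $H_j\ne\emptyset$, $h_j=\min H_j$. For given functions $a_1,\dots,a_m$ and $b_0,\dots,b_{n_0-1}\in\mathbb R$ consider the initial value problem $${}^cD_{0+}^{\alpha_0}y(t)=-\sum_{i=1}^m a_i(t)\,{}^cD_{0+}^{\alpha_i}y(t),\quad 0<t<T,\qquad (1)$$ $$D^ky(t)\big|_{t=+0}=b_k,\quad k=0,1,\dots,n_0-1.\qquad (2)$$ Assume that $0<\gamma=n_0-\alpha_0<1$, that $n_0=n_1$, that $a_i\in C_\gamma^1[0,T]$ and $D_{0+}^{n_0-\alpha_0}a_i\in C[0,T]$ for $i=1,\dots,m$, and that $n_0\ge 2$ and $j_0\in\{0,\dots,n_0-2\}$ is such that $H_{j_0}=\emptyset$ and $H_{j_0+1}\ne\emptyset$. Then (1) has exactly one canonical fundamental system $y_0,\dots,y_{n_0-1}$ in $C_\gamma^{n_0}[0,T]$, that is, a system of solutions of (1) in $C_\gamma^{n_0}[0,T]$ with $D^ky_j(t)|_{t=+0}=1$ for $k=j$ and $=0$ for $k\ne j$ ($0\le k,j\le n_0-1$),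 and it is given by $$y_j(t)=\Phi_{j+1}(t),\quad j=0,1,\dots,j_0,\qquad (16)$$ $$y_j(t)=\Phi_{j+1}(t)+\sum_{k=0}^{\infty}(-1)^{k+1}I_{0+}^{\alpha_0}\Bigl[\sum_{i=1}^m a_i(t)I_{0+}^{\alpha_0-\alpha_i}\Bigr]^k\sum_{i=h_j}^m a_i(t)\Phi_{j+1-\alpha_i}(t),\quad j=j_0+1,\dots,n_0-1,\qquad (17)$$ where the partial sums of the series belong to $C_\gamma^{n_0}[0,T]$ and converge in the norm of $C_\gamma^{n_0}[0,T]$. For all $b_0,\dots,b_{n_0-1}\in\mathbb R$ the problem (1)-(2) has a unique solution $y\in C_\gamma^{n_0}[0,T]$, and this solution is $y(t)=\sum_{j=0}^{n_0-1}b_jy_j(t)$. -/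

import Mathlib

open Set Filter Topology

namespace CaputoFDE

noncomputable section

/- Functions on `[0, T]` (or on `(0, T]`) are represented by functions `ℝ → ℝ` of which only the
values on `[0, T]` (or on `(0, T]`) matter: all derivatives are taken within these intervals. -/

/-- The weighted space `C_γ[0, T]`: functions `f` on `(0, T]` such that `t ^ γ * f t` extends
to a continuous function on `[0, T]`. For `γ = 0` this is `C[0, T]`. -/
def MemC (T γ : ℝ) (f : ℝ → ℝ) : Prop :=
  ∃ g : ℝ → ℝ, ContinuousOn g (Icc 0 T) ∧ ∀ t ∈ Ioc 0 T, g t = t ^ γ * f t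

/-- The space `C_γ^n[0, T]`: functions that are `n - 1` times continuously differentiable on
`[0, T]` and have an `n`-th derivative on `(0, T]` which belongs to `C_γ[0, T]`;
`C_γ^0[0, T] = C_γ[0, T]`. -/
def MemCn (T γ : ℝ) : ℕ → (ℝ → ℝ) → Prop
  | 0, f => MemC T γ f
  | n + 1, f =>
      ContDiffOn ℝ n f (Icc 0 T) ∧
      (∀ t ∈ Ioc 0 T,
        DifferentiableWithinAt ℝ (iteratedDerivWithin n f (Icc 0 T)) (Icc 0 T) t) ∧
      MemC T γ (iteratedDerivWithin (n + 1) f (Icc 0 T))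

/-- Convergence of a sequence of elements of `C_γ^n[0, T]` to an element of `C_γ^n[0, T]` in the
norm `∑ k < n, sup_{[0, T]} |f^(k)| + sup_{(0, T]} |t ^ γ * f^(n)|`. -/
def TendstoCn (T γ : ℝ) (n : ℕ) (S : ℕ → ℝ → ℝ) (f : ℝ → ℝ) : Prop :=
  (∀ N, MemCn T γ n (S N)) ∧ MemCn T γ n f ∧
  (∀ k < n, TendstoUniformlyOn (fun N => iteratedDerivWithin k (S N) (Icc 0 T))
    (iteratedDerivWithin k f (Icc 0 T)) atTop (Icc 0 T)) ∧
  TendstoUniformlyOn (fun N t => t ^ γ * iteratedDerivWithin n (S N) (Icc 0 T) t)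
    (fun t => t ^ γ * iteratedDerivWithin n f (Icc 0 T) t) atTop (Ioc 0 T)

/-- The Riemann-Liouville fractional integral `I_{0+}^α f`, with `I_{0+}^0 f = f`. -/
def rlInt (α : ℝ) (f : ℝ → ℝ) (t : ℝ) : ℝ :=
  if α = 0 then f t
  else 1 / Real.Gamma α * ∫ τ in (0 : ℝ)..t, (t - τ) ^ (α - 1) * f τ

/-- The Riemann-Liouville fractional derivative `D_{0+}^α f = (d/dt)^n I_{0+}^{n-α} f` on
`(0, T]`, where `n - 1 < α ≤ n`. -/
def rlDeriv (T α : ℝ) (f : ℝ → ℝ) (t : ℝ) : ℝ :=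
  iteratedDerivWithin ⌈α⌉₊ (rlInt (⌈α⌉₊ - α) f) (Ioc 0 T) t

/-- `D_{0+}^α f` exists at `t`: the `n` successive derivatives in its definition do. -/
def RlDerivExistsAt (T α : ℝ) (f : ℝ → ℝ) (t : ℝ) : Prop :=
  ∀ k < ⌈α⌉₊, DifferentiableWithinAt ℝ
    (iteratedDerivWithin k (rlInt (⌈α⌉₊ - α) f) (Ioc 0 T)) (Ioc 0 T) t

/-- `f(t) - ∑_{k < n} f^(k)(0) / k! * t ^ k`, the `f^(k)(0)` being one-sided derivatives. -/
def taylorRemainder (T : ℝ) (n : ℕ) (f : ℝ → ℝ) (t : ℝ) : ℝ :=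
  f t - ∑ k ∈ Finset.range n, iteratedDerivWithin k f (Icc 0 T) 0 / (k.factorial : ℝ) * t ^ k

/-- The Caputo fractional derivative on `(0, T]`: the Riemann-Liouville derivative `D_{0+}^α` of
`f(t) - ∑_{k < n} f^(k)(0) / k! * t ^ k`, where `n - 1 < α ≤ n`. -/
def caputo (T α : ℝ) (f : ℝ → ℝ) (t : ℝ) : ℝ :=
  rlDeriv T α (taylorRemainder T ⌈α⌉₊ f) t

/-- The Caputo derivative of order `α` of `f` exists at `t`. -/
def CaputoExistsAt (T α : ℝ) (f : ℝ → ℝ) (t : ℝ) : Prop :=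
  RlDerivExistsAt T α (taylorRemainder T ⌈α⌉₊ f) t

/-- `y` satisfies the equation
`cD^{α 0} y(t) = - ∑_{i = 1}^m a i (t) * cD^{α i} y(t)`, `0 < t < T`,
all the Caputo derivatives in it being required to exist. -/
def SolvesEq (T : ℝ) (m : ℕ) (α : ℕ → ℝ) (a : ℕ → ℝ → ℝ) (y : ℝ → ℝ) : Prop :=
  ∀ t ∈ Ioo 0 T, (∀ i ≤ m, CaputoExistsAt T (α i) y t) ∧
    caputo T (α 0) y t = -∑ i ∈ Finset.Icc 1 m, a i t * caputo T (α i) y t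

/-- The initial conditions `D^k y(t)|_{t = +0} = b k`, `k = 0, …, n - 1`. -/
def InitialConditions (T : ℝ) {n : ℕ} (b : Fin n → ℝ) (y : ℝ → ℝ) : Prop :=
  ∀ k : Fin n, Tendsto (iteratedDerivWithin (k : ℕ) y (Icc 0 T)) (𝓝[>] 0) (𝓝 (b k))

/-- Canonical fundamental systems of solutions `y_0, …, y_{n-1}`. -/
def IsCanonicalFundamentalSystem (T : ℝ) (m : ℕ) (α : ℕ → ℝ) (a : ℕ → ℝ → ℝ) {n : ℕ}
    (y : Fin n → ℝ → ℝ) : Prop :=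
  ∀ j, SolvesEq T m α a (y j) ∧ InitialConditions T (fun k => if j = k then 1 else 0) (y j)

/-- The index set `H_j = {i : 0 ≤ α i ≤ j, i = 1, …, m}`. -/
def H (m : ℕ) (α : ℕ → ℝ) (j : ℕ) : Set ℕ :=
  {i | 1 ≤ i ∧ i ≤ m ∧ 0 ≤ α i ∧ α i ≤ j}

/-- `h_j = min H_j` (used for `H_j ≠ ∅` only). -/
def h (m : ℕ) (α : ℕ → ℝ) (j : ℕ) : ℕ := sInf (H m α j)

/-- `Φ_β(t) = t ^ (β - 1) / Γ(β)`; in particular `Φ_{k+1}(t) = t ^ k / k!`. -/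
def Phi (β t : ℝ) : ℝ := t ^ (β - 1) / Real.Gamma β

/-- The operator `f ↦ ∑_{i = 1}^m a i (t) * I_{0+}^{α 0 - α i} f(t)`. -/
def A (m : ℕ) (α : ℕ → ℝ) (a : ℕ → ℝ → ℝ) (f : ℝ → ℝ) (t : ℝ) : ℝ :=
  ∑ i ∈ Finset.Icc 1 m, a i t * rlInt (α 0 - α i) f t

/-- The function `∑_{i = h_j}^m a i (t) * Φ_{j+1-α i}(t)`. -/
def G (m : ℕ) (α : ℕ → ℝ) (a : ℕ → ℝ → ℝ) (j : ℕ) (t : ℝ) : ℝ :=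
  ∑ i ∈ Finset.Icc (h m α j) m, a i t * Phi (j + 1 - α i) t

/-- The partial sums (terms `k = 0, …, N - 1`) of
`Φ_{j+1}(t) + ∑_k (-1)^(k+1) * I_{0+}^{α 0} [∑_i a i I_{0+}^{α 0 - α i}]^k ∑_{i ≥ h_j} a i Φ_{j+1-α i}`. -/
def partialSum (m : ℕ) (α : ℕ → ℝ) (a : ℕ → ℝ → ℝ) (j N : ℕ) (t : ℝ) : ℝ :=
  Phi (j + 1) t +
    ∑ k ∈ Finset.range N, (-1) ^ (k + 1) * rlInt (α 0) ((A m α a)^[k] (G m α a j)) t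

end

end CaputoFDE

open CaputoFDE

namespace CaputoFDE

open MeasureTheory

/-! ### The Beta integral -/

/-! The natural unknown is not `y` but `u`, its Caputo derivative of order `α 0`. Write `y = ∑ b_j
Φ_{j+1} + I^{α 0} u`. By the semigroup law, every lower Caputo derivative is `I^{α 0 - α i} u` plus
the terms `b_j Φ_{j+1-α i}` with `j ≥ α i` (`caputo_polyPart_add_rlInt`). The equation becomes the
Volterra equation `u = -g - A u`, where `g` (`forcing`) depends linearly on the data. For the `j`-th
unit data `g` is zero when `H_j` is empty, whence `y_j = Φ_{j+1}`; otherwise it is `G`, and `I^{α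
0}` of the Neumann series of `-(1 + A)⁻¹ G` is the series to be found.

Convergence: for `β ≤ α 0 - α i`, the operator `A` turns a bound `M t^(d-1)` into `ρ(d) M
t^(β+d-1)`, and `ρ(d) → 0` because `Γ(d) / Γ(c+d) → 0` (`tendsto_Gamma_ratio`, `exists_A_bound`).
The ratios of successive bounds tend to zero, so the series converges whatever `T` and the size of
the coefficients.

Regularity: since `α 0 < n 0`, uniform control of `u` alone does not control the `n 0`-th derivative
of `I^{α 0} u`. The extra information carried along is the Euler derivative `t u'`. From `I^c u(t) =
t^c / Γ(c) ∫₀¹ (1-x)^(c-1) u(tx) dx` one gets `t (I^c u)' = c I^c u + I^c (t u')`. Hence pairs `(u,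
t u')` continuous up to `0` (`EulerPair`) survive `I^c`, multiplication by `a i`, the operator `A`
and uniform limits, and the weighted top derivative of `y` is a fractional integral of such a pair.

Uniqueness: the difference `w` of the `n 0`-th derivatives of two solutions is only in `C_γ`, but `d
= I^γ w` is bounded and `d = -A d`. Iterating the bound for `A` gives `d = 0`, and Taylor's formula
with fractional integrals recovers the solutions (`eqOn_of_solvesEq`). -/

theorem intervalIntegrable_beta {c d : ℝ} (hc : 0 < c) (hd : 0 < d) :
    IntervalIntegrable (fun x : ℝ => (1 - x) ^ (c - 1) * x ^ (d - 1)) volume 0 1 := by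
  have h1 := Complex.betaIntegral_convergent (u := d) (v := c) (by simpa) (by simpa)
  have h2 := h1.norm
  refine h2.congr_uIoo fun x hx => ?_
  rw [uIoo_of_le zero_le_one] at hx
  have hx1 : 0 < 1 - x := by linarith [hx.2]
  have e1 : ‖(x : ℂ) ^ ((d : ℂ) - 1)‖ = x ^ (d - 1) := by
    rw [Complex.norm_cpow_eq_rpow_re_of_pos hx.1]; simp
  have e2 : ‖(1 - (x : ℂ)) ^ ((c : ℂ) - 1)‖ = (1 - x) ^ (c - 1) := by
    have : (1 - (x : ℂ)) = ((1 - x : ℝ) : ℂ) := by push_cast; ring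
    rw [this, Complex.norm_cpow_eq_rpow_re_of_pos hx1]; simp
  simp only [norm_mul, e1, e2]
  ring

theorem integral_beta {c d : ℝ} (hc : 0 < c) (hd : 0 < d) :
    ∫ x in (0 : ℝ)..1, (1 - x) ^ (c - 1) * x ^ (d - 1)
      = Real.Gamma c * Real.Gamma d / Real.Gamma (c + d) := by
  have h1 := ProbabilityTheory.beta_eq_betaIntegralReal d c hd hc
  rw [ProbabilityTheory.beta, add_comm d c, mul_comm (Real.Gamma d)] at h1
  rw [h1]
  have h2 : Complex.betaIntegral d c
      = ((∫ x in (0 : ℝ)..1, (1 - x) ^ (c - 1) * x ^ (d - 1) : ℝ) : ℂ) := by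
    rw [Complex.betaIntegral, ← intervalIntegral.integral_ofReal]
    refine intervalIntegral.integral_congr fun x hx => ?_
    rw [uIcc_of_le zero_le_one] at hx
    have hx1 : 0 ≤ 1 - x := by linarith [hx.2]
    push_cast [Complex.ofReal_cpow hx.1, Complex.ofReal_cpow hx1]
    ring
  rw [h2, Complex.ofReal_re]

theorem intervalIntegrable_kernel {c d t : ℝ} (hc : 0 < c) (hd : 0 < d) (ht : 0 ≤ t) :
    IntervalIntegrable (fun τ : ℝ => (t - τ) ^ (c - 1) * τ ^ (d - 1)) volume 0 t := by
  rcases ht.eq_or_lt with rfl | ht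
  · exact IntervalIntegrable.refl
  have h1 := (intervalIntegrable_beta hc hd).comp_mul_left (c := t⁻¹)
  simp only [zero_div, one_div, inv_inv] at h1
  have h2 := h1.const_mul (t ^ (c - 1) * t ^ (d - 1))
  refine h2.congr_uIoo fun x hx => ?_
  rw [uIoo_of_le ht.le] at hx
  have hx1 : 0 < 1 - t⁻¹ * x := by
    rw [sub_pos, inv_mul_lt_iff₀ ht]; linarith [hx.2]
  have hx2 : 0 < t⁻¹ * x := mul_pos (inv_pos.2 ht) hx.1
  have e1 : t - x = t * (1 - t⁻¹ * x) := by field_simp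
  have e2 : x ^ (d - 1) = t ^ (d - 1) * (t⁻¹ * x) ^ (d - 1) := by
    rw [← Real.mul_rpow ht.le hx2.le]; congr 1; field_simp
  simp only [e1, e2, Real.mul_rpow ht.le hx1.le]
  ring

/-! ### Elementary properties of the fractional integral -/

theorem rlInt_zero_left (f : ℝ → ℝ) : rlInt 0 f = f := by
  funext t; simp [rlInt]

theorem rlInt_of_pos {c : ℝ} (hc : 0 < c) (f : ℝ → ℝ) (t : ℝ) :
    rlInt c f t = 1 / Real.Gamma c * ∫ τ in (0 : ℝ)..t, (t - τ) ^ (c - 1) * f τ := by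
  simp [rlInt, hc.ne']

theorem rlInt_apply_zero {c : ℝ} (hc : 0 < c) (f : ℝ → ℝ) : rlInt c f 0 = 0 := by
  simp [rlInt_of_pos hc]

theorem rlInt_one (f : ℝ → ℝ) (t : ℝ) : rlInt 1 f t = ∫ τ in (0 : ℝ)..t, f τ := by
  simp [rlInt_of_pos one_pos]

/-- The substitution `τ = t x` frees the kernel and the limits of integration of `t`, so that
continuity and differentiation in `t` become questions about a parameter in `f` only. -/
theorem rlInt_eq_scaled {c t : ℝ} (hc : 0 < c) (ht : 0 < t) (f : ℝ → ℝ) :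
    rlInt c f t
      = t ^ c * (1 / Real.Gamma c * ∫ x in (0 : ℝ)..1, (1 - x) ^ (c - 1) * f (t * x)) := by
  rw [rlInt_of_pos hc]
  have h1 := intervalIntegral.integral_comp_mul_left
    (fun τ => (t - τ) ^ (c - 1) * f τ) ht.ne' (a := 0) (b := 1)
  simp only [mul_zero, mul_one, smul_eq_mul] at h1
  have h2 : ∫ τ in (0 : ℝ)..t, (t - τ) ^ (c - 1) * f τ
      = t * ∫ x in (0 : ℝ)..1, (t - t * x) ^ (c - 1) * f (t * x) := by
    rw [h1]; field_simp
  have h3 : ∫ x in (0 : ℝ)..1, (t - t * x) ^ (c - 1) * f (t * x)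
      = t ^ (c - 1) * ∫ x in (0 : ℝ)..1, (1 - x) ^ (c - 1) * f (t * x) := by
    rw [← intervalIntegral.integral_const_mul]
    refine intervalIntegral.integral_congr fun x hx => ?_
    rw [uIcc_of_le zero_le_one] at hx
    have : t - t * x = t * (1 - x) := by ring
    simp only [this, Real.mul_rpow ht.le (sub_nonneg.2 hx.2)]
    ring
  have h4 : t ^ c = t * t ^ (c - 1) := by
    rw [Real.rpow_sub_one ht.ne']; field_simp
  rw [h2, h3, h4]; ring

theorem rlInt_congr {c t : ℝ} (hc : 0 ≤ c) (ht : 0 < t) {f g : ℝ → ℝ}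
    (hfg : EqOn f g (Ioc 0 t)) : rlInt c f t = rlInt c g t := by
  rcases hc.eq_or_lt with rfl | hc
  · simpa [rlInt_zero_left] using hfg ⟨ht, le_rfl⟩
  rw [rlInt_of_pos hc, rlInt_of_pos hc]
  congr 1
  refine intervalIntegral.integral_congr_ae (Eventually.of_forall fun x hx => ?_)
  rw [uIoc_of_le ht.le] at hx
  simp only [hfg hx]

theorem rlInt_congr_Ioc {c T : ℝ} (hc : 0 ≤ c) {f g : ℝ → ℝ} (hfg : EqOn f g (Ioc 0 T)) :
    EqOn (rlInt c f) (rlInt c g) (Ioc 0 T) := fun _ ht =>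
  rlInt_congr hc ht.1 (hfg.mono (Ioc_subset_Ioc_right ht.2))

theorem rlInt_congr_Icc {c T : ℝ} (hc : 0 < c) {f g : ℝ → ℝ} (hfg : EqOn f g (Ioc 0 T)) :
    EqOn (rlInt c f) (rlInt c g) (Icc 0 T) := fun t ht => by
  rcases ht.1.eq_or_lt with rfl | h0
  · simp [rlInt_apply_zero hc]
  · exact rlInt_congr_Ioc hc.le hfg ⟨h0, ht.2⟩

theorem rlInt_rpow {c d t : ℝ} (hc : 0 < c) (hd : 0 < d) (ht : 0 < t) :
    rlInt c (fun s => s ^ (d - 1)) t = Real.Gamma d / Real.Gamma (c + d) * t ^ (c + d - 1) := by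
  rw [rlInt_eq_scaled hc ht]
  have h3 : ∫ x in (0 : ℝ)..1, (1 - x) ^ (c - 1) * (t * x) ^ (d - 1)
      = t ^ (d - 1) * ∫ x in (0 : ℝ)..1, (1 - x) ^ (c - 1) * x ^ (d - 1) := by
    rw [← intervalIntegral.integral_const_mul]
    refine intervalIntegral.integral_congr fun x hx => ?_
    rw [uIcc_of_le zero_le_one] at hx
    simp only [Real.mul_rpow ht.le hx.1]
    ring
  rw [h3, integral_beta hc hd, add_sub_assoc, Real.rpow_add ht]
  have := (Real.Gamma_pos_of_pos hc).ne'
  field_simp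

theorem rlInt_Phi {c d t : ℝ} (hc : 0 ≤ c) (hd : 0 < d) (ht : 0 < t) :
    rlInt c (Phi d) t = Phi (d + c) t := by
  rcases hc.eq_or_lt with rfl | hc
  · simp [rlInt_zero_left]
  have h1 := rlInt_rpow hc hd ht
  have h2 : rlInt c (Phi d) t = 1 / Real.Gamma d * rlInt c (fun s => s ^ (d - 1)) t := by
    simp only [rlInt_of_pos hc, Phi]
    rw [mul_left_comm, ← intervalIntegral.integral_const_mul (1 / Real.Gamma d)]
    congr 2
    funext x; ring
  rw [h2, h1, Phi, add_comm d c]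
  have := (Real.Gamma_pos_of_pos hd).ne'
  field_simp

/-- Comparison with the explicit fractional integral of a power. No measurability of `f` is needed:
only the dominating function has to be integrable. -/
theorem abs_rlInt_le {c d t M : ℝ} (hc : 0 < c) (hd : 0 < d) (ht : 0 < t) {f : ℝ → ℝ}
    (hf : ∀ s ∈ Ioo 0 t, |f s| ≤ M * s ^ (d - 1)) :
    |rlInt c f t| ≤ M * (Real.Gamma d / Real.Gamma (c + d) * t ^ (c + d - 1)) := by
  have hG := Real.Gamma_pos_of_pos hc
  rw [← rlInt_rpow hc hd ht, rlInt_of_pos hc, rlInt_of_pos hc, abs_mul,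
    abs_of_pos (one_div_pos.2 hG), mul_left_comm]
  refine mul_le_mul_of_nonneg_left ?_ (one_div_pos.2 hG).le
  rw [← intervalIntegral.integral_const_mul, ← Real.norm_eq_abs]
  refine intervalIntegral.norm_integral_le_of_norm_le ht.le ?_
    ((intervalIntegrable_kernel hc hd ht.le).const_mul M)
  filter_upwards [compl_mem_ae_iff.2 (measure_singleton t)] with s hs hs'
  have hs2 : s ∈ Ioo 0 t := ⟨hs'.1, lt_of_le_of_ne hs'.2 hs⟩
  have hp : 0 ≤ (t - s) ^ (c - 1) := Real.rpow_nonneg (by linarith [hs'.2]) _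
  rw [norm_mul, Real.norm_eq_abs, Real.norm_eq_abs, abs_of_nonneg hp, mul_left_comm]
  exact mul_le_mul_of_nonneg_left (hf s hs2) hp

/-- Up to the factor `1 / Γ(c)` this is the Beta integral of `(1-x)^(c-1) x^(d-1)`, whose integrand
tends to `0` on `(0, 1)`; dominated convergence applies, with the integrand at `d = 1` as bound.
This decay makes the Neumann series converge without any smallness assumption. -/
theorem tendsto_Gamma_ratio {c : ℝ} (hc : 0 < c) :
    Tendsto (fun d : ℝ => Real.Gamma d / Real.Gamma (c + d)) atTop (𝓝 0) := by
  have hG := Real.Gamma_pos_of_pos hc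
  have h1 : Tendsto (fun d : ℝ => ∫ x in (0 : ℝ)..1, (1 - x) ^ (c - 1) * x ^ (d - 1)) atTop
      (𝓝 (∫ x in (0 : ℝ)..1, (0 : ℝ))) := by
    refine intervalIntegral.tendsto_integral_filter_of_dominated_convergence
      (fun x => (1 - x) ^ (c - 1) * x ^ ((1 : ℝ) - 1)) ?_ ?_
      (intervalIntegrable_beta hc one_pos) ?_
    · exact Eventually.of_forall fun d => by fun_prop
    · filter_upwards [eventually_ge_atTop 1] with d hd
      filter_upwards with x hx
      rw [uIoc_of_le zero_le_one] at hx
      have hp : 0 ≤ (1 - x) ^ (c - 1) := Real.rpow_nonneg (by linarith [hx.2]) _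
      rw [norm_mul, Real.norm_eq_abs, Real.norm_eq_abs, abs_of_nonneg hp,
        abs_of_nonneg (Real.rpow_nonneg hx.1.le _)]
      exact mul_le_mul_of_nonneg_left
        (Real.rpow_le_rpow_of_exponent_ge hx.1 hx.2 (by linarith)) hp
    · filter_upwards [compl_mem_ae_iff.2 (measure_singleton (1 : ℝ))] with x hx hx'
      rw [uIoc_of_le zero_le_one] at hx'
      have hx1 : x < 1 := lt_of_le_of_ne hx'.2 hx
      have h2 := (tendsto_rpow_atTop_of_base_lt_one x (by linarith [hx'.1]) hx1).comp
        (tendsto_atTop_add_const_right atTop (-1 : ℝ) tendsto_id)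
      simpa [← sub_eq_add_neg, Function.comp_def] using h2.const_mul ((1 - x) ^ (c - 1))
  have h2 := h1.const_mul (1 / Real.Gamma c)
  rw [intervalIntegral.integral_zero, mul_zero] at h2
  refine h2.congr' ?_
  filter_upwards [eventually_gt_atTop 0] with d hd
  rw [integral_beta hc hd]
  field_simp

/-! ### The fractional integral on the weighted spaces -/

/-- The continuous factor is extended from `[0, T]` to the line by its endpoint values, so that it
is globally continuous, measurable and bounded. -/
theorem MemC.exists_continuous {T γ : ℝ} (hT : 0 ≤ T) {f : ℝ → ℝ} (hf : MemC T γ f) :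
    ∃ g : ℝ → ℝ, Continuous g ∧ (∃ C, ∀ x, |g x| ≤ C) ∧
      ∀ t ∈ Ioc 0 T, f t = t ^ (-γ) * g t := by
  obtain ⟨g, hg, hgf⟩ := hf
  refine ⟨IccExtend hT ((Icc 0 T).domRestrict g), hg.domRestrict.Icc_extend', ?_, ?_⟩
  · obtain ⟨C, hC⟩ := isCompact_Icc.exists_bound_of_continuousOn hg
    exact ⟨C, fun x => hC _ (projIcc 0 T hT x).2⟩
  · intro t ht
    rw [IccExtend_of_mem _ _ (Ioc_subset_Icc_self ht)]
    change f t = t ^ (-γ) * g t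
    rw [hgf t ht, ← mul_assoc, ← Real.rpow_add ht.1]
    simp

theorem memC_zero_of_continuousOn {T : ℝ} {f : ℝ → ℝ} (hf : ContinuousOn f (Icc 0 T)) :
    MemC T 0 f := ⟨f, hf, fun t _ => by simp⟩

theorem MemC.mono {T γ δ : ℝ} {f : ℝ → ℝ} (hf : MemC T γ f) (hγ : γ ≤ δ) : MemC T δ f := by
  obtain ⟨u, hu, huf⟩ := hf
  refine ⟨fun t => t ^ (δ - γ) * u t, ?_, fun t ht => ?_⟩
  · exact (Real.continuous_rpow_const (by linarith)).continuousOn.mul hu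
  · simp only [huf t ht]
    rw [← mul_assoc, ← Real.rpow_add ht.1]
    simp

theorem MemC.add {T γ : ℝ} {f g : ℝ → ℝ} (hf : MemC T γ f) (hg : MemC T γ g) :
    MemC T γ (fun t => f t + g t) := by
  obtain ⟨u, hu, huf⟩ := hf
  obtain ⟨v, hv, hvf⟩ := hg
  exact ⟨fun t => u t + v t, hu.add hv, fun t ht => by simp only [huf t ht, hvf t ht]; ring⟩

theorem MemC.const_mul {T γ : ℝ} {f : ℝ → ℝ} (hf : MemC T γ f) (k : ℝ) :
    MemC T γ (fun t => k * f t) := by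
  obtain ⟨u, hu, huf⟩ := hf
  exact ⟨fun t => k * u t, hu.const_smul k, fun t ht => by simp only [huf t ht]; ring⟩

theorem MemC.continuousOn {T γ : ℝ} {f : ℝ → ℝ} (hf : MemC T γ f) :
    ContinuousOn f (Ioc 0 T) := by
  obtain ⟨u, hu, huf⟩ := hf
  have h1 : ContinuousOn (fun t : ℝ => t ^ (-γ) * u t) (Ioc 0 T) :=
    (continuousOn_id.rpow_const fun t ht => Or.inl ht.1.ne').mul (hu.mono Ioc_subset_Icc_self)
  refine h1.congr fun t ht => ?_
  simp only [huf t ht]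
  rw [← mul_assoc, ← Real.rpow_add ht.1]
  simp

theorem MemC.exists_bound {T γ : ℝ} (hT : 0 ≤ T) {f : ℝ → ℝ} (hf : MemC T γ f) :
    ∃ C, 0 ≤ C ∧ ∀ t ∈ Ioc 0 T, |f t| ≤ C * t ^ (-γ) := by
  obtain ⟨g, -, ⟨C, hC⟩, hg⟩ := hf.exists_continuous hT
  refine ⟨C, (abs_nonneg _).trans (hC 0), fun t ht => ?_⟩
  have hp := Real.rpow_nonneg ht.1.le (-γ)
  rw [hg t ht, abs_mul, abs_of_nonneg hp, mul_comm]
  exact mul_le_mul_of_nonneg_right (hC t) hp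

theorem MemC.intervalIntegrable_mul {T γ c t : ℝ} {f : ℝ → ℝ} (hf : MemC T γ f) (hγ : γ < 1)
    (hc : 0 < c) (ht : t ∈ Icc 0 T) :
    IntervalIntegrable (fun τ => (t - τ) ^ (c - 1) * f τ) volume 0 t := by
  obtain ⟨g, hg, -, hgf⟩ := hf.exists_continuous (ht.1.trans ht.2)
  have h1 := (intervalIntegrable_kernel hc (sub_pos.2 hγ) ht.1).mul_continuousOn
    (hg.continuousOn (s := uIcc 0 t))
  refine h1.congr fun x hx => ?_
  rw [uIoc_of_le ht.1] at hx
  have hx' : x ∈ Ioc 0 T := ⟨hx.1, hx.2.trans ht.2⟩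
  simp only [hgf x hx']
  rw [show 1 - γ - 1 = -γ by ring]
  ring

theorem MemC.intervalIntegrable {T γ t : ℝ} {f : ℝ → ℝ} (hf : MemC T γ f) (hγ : γ < 1)
    (ht : t ∈ Icc 0 T) : IntervalIntegrable f volume 0 t := by
  simpa using hf.intervalIntegrable_mul hγ one_pos ht

theorem rlInt_add {T γ c t : ℝ} {f g : ℝ → ℝ} (hf : MemC T γ f) (hg : MemC T γ g) (hγ : γ < 1)
    (hc : 0 ≤ c) (ht : t ∈ Icc 0 T) :
    rlInt c (fun s => f s + g s) t = rlInt c f t + rlInt c g t := by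
  rcases hc.eq_or_lt with rfl | hc
  · simp [rlInt_zero_left]
  simp only [rlInt_of_pos hc, mul_add]
  rw [intervalIntegral.integral_add (hf.intervalIntegrable_mul hγ hc ht)
    (hg.intervalIntegrable_mul hγ hc ht), mul_add]

theorem rlInt_const_mul (c k t : ℝ) (f : ℝ → ℝ) :
    rlInt c (fun s => k * f s) t = k * rlInt c f t := by
  unfold rlInt
  split_ifs
  · rfl
  · rw [mul_left_comm, ← intervalIntegral.integral_const_mul k]
    congr 2
    funext x; ring

theorem rlInt_sub {T γ c t : ℝ} {f g : ℝ → ℝ} (hf : MemC T γ f) (hg : MemC T γ g) (hγ : γ < 1)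
    (hc : 0 ≤ c) (ht : t ∈ Icc 0 T) :
    rlInt c (fun s => f s - g s) t = rlInt c f t - rlInt c g t := by
  have h1 := rlInt_add hf (hg.const_mul (-1)) hγ hc ht
  rw [rlInt_const_mul] at h1
  simp only [neg_one_mul, ← sub_eq_add_neg] at h1
  exact h1

theorem MemC.sum {T γ : ℝ} {ι : Type*} (s : Finset ι) {f : ι → ℝ → ℝ}
    (hf : ∀ i ∈ s, MemC T γ (f i)) : MemC T γ (fun t => ∑ i ∈ s, f i t) := by
  classical
  induction s using Finset.induction_on with
  | empty => exact ⟨fun _ => 0, continuousOn_const, fun t _ => by simp⟩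
  | insert i s hi ih =>
    simp only [Finset.sum_insert hi]
    exact (hf i (by simp)).add (ih fun j hj => hf j (by simp [hj]))

theorem rlInt_sum {T γ c t : ℝ} {ι : Type*} (s : Finset ι) {f : ι → ℝ → ℝ}
    (hf : ∀ i ∈ s, MemC T γ (f i)) (hγ : γ < 1) (hc : 0 ≤ c) (ht : t ∈ Icc 0 T) :
    rlInt c (fun r => ∑ i ∈ s, f i r) t = ∑ i ∈ s, rlInt c (f i) t := by
  classical
  induction s using Finset.induction_on with
  | empty => simpa using rlInt_const_mul c 0 t (fun _ => 0)
  | insert i s hi ih =>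
    simp only [Finset.sum_insert hi]
    rw [rlInt_add (hf i (by simp)) (MemC.sum s fun j hj => hf j (by simp [hj])) hγ hc ht,
      ih fun j hj => hf j (by simp [hj])]

/-- The scaled form `I^c f (t) = t ^ (c - γ) * (continuous function)`. -/
theorem MemC.exists_rlInt_eq {T γ c : ℝ} (hT : 0 ≤ T) {f : ℝ → ℝ} (hf : MemC T γ f) (hγ : γ < 1)
    (hc : 0 < c) : ∃ u : ℝ → ℝ, Continuous u ∧
      ∀ t ∈ Ioc 0 T, rlInt c f t = t ^ (c - γ) * u t := by
  obtain ⟨g, hg, ⟨C, hC⟩, hgf⟩ := hf.exists_continuous hT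
  refine ⟨fun t => 1 / Real.Gamma c *
    ∫ x in (0 : ℝ)..1, (1 - x) ^ (c - 1) * x ^ (1 - γ - 1) * g (t * x), ?_, fun t ht => ?_⟩
  · refine continuous_const.mul (intervalIntegral.continuous_of_dominated_interval
      (bound := fun x => (1 - x) ^ (c - 1) * x ^ (1 - γ - 1) * C) ?_ ?_
      ((intervalIntegrable_beta hc (sub_pos.2 hγ)).mul_const C) ?_)
    · intro t
      have : Measurable g := hg.measurable
      fun_prop
    · intro t
      filter_upwards with x hx
      rw [uIoc_of_le zero_le_one] at hx
      have hp : 0 ≤ (1 - x) ^ (c - 1) * x ^ (1 - γ - 1) :=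
        mul_nonneg (Real.rpow_nonneg (by linarith [hx.2]) _) (Real.rpow_nonneg hx.1.le _)
      rw [norm_mul, Real.norm_eq_abs, Real.norm_eq_abs, abs_of_nonneg hp]
      exact mul_le_mul_of_nonneg_left (hC _) hp
    · filter_upwards with x _
      fun_prop
  · rw [rlInt_eq_scaled hc ht.1, show c - γ = c + -γ by ring, Real.rpow_add ht.1]
    have h1 : ∫ x in (0 : ℝ)..1, (1 - x) ^ (c - 1) * f (t * x)
        = t ^ (-γ) * ∫ x in (0 : ℝ)..1, (1 - x) ^ (c - 1) * x ^ (1 - γ - 1) * g (t * x) := by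
      rw [← intervalIntegral.integral_const_mul]
      refine intervalIntegral.integral_congr_ae (Eventually.of_forall fun x hx => ?_)
      rw [uIoc_of_le zero_le_one] at hx
      have hx' : t * x ∈ Ioc 0 T :=
        ⟨mul_pos ht.1 hx.1, (mul_le_of_le_one_right ht.1.le hx.2).trans ht.2⟩
      simp only [hgf _ hx', Real.mul_rpow ht.1.le hx.1.le]
      rw [show 1 - γ - 1 = -γ by ring]
      ring
    rw [h1]; ring

theorem MemC.rlInt {T γ δ c : ℝ} (hT : 0 ≤ T) {f : ℝ → ℝ} (hf : MemC T γ f) (hγ : γ < 1)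
    (hc : 0 ≤ c) (hδ : γ - c ≤ δ) : MemC T δ (rlInt c f) := by
  rcases hc.eq_or_lt with rfl | hc
  · rw [rlInt_zero_left]; exact hf.mono (by linarith)
  obtain ⟨u, hu, huf⟩ := hf.exists_rlInt_eq hT hγ hc
  refine ⟨fun t => t ^ (δ + c - γ) * u t, ?_, fun t ht => ?_⟩
  · exact ((Real.continuous_rpow_const (by linarith)).mul hu).continuousOn
  · rw [huf t ht, ← mul_assoc, ← Real.rpow_add ht.1]
    ring_nf

theorem MemC.continuousOn_rlInt {T γ c : ℝ} (hT : 0 ≤ T) {f : ℝ → ℝ} (hf : MemC T γ f)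
    (hγ : γ < 1) (hc : 0 < c) (hγc : γ < c) : ContinuousOn (CaputoFDE.rlInt c f) (Icc 0 T) := by
  obtain ⟨u, hu, huf⟩ := hf.exists_rlInt_eq hT hγ hc
  have h1 : Continuous fun t : ℝ => t ^ (c - γ) * u t :=
    (Real.continuous_rpow_const (by linarith)).mul hu
  refine h1.continuousOn.congr fun t ht => ?_
  rcases ht.1.eq_or_lt with rfl | h0
  · simp only [rlInt_apply_zero hc, Real.zero_rpow (sub_pos.2 hγc).ne', zero_mul]
  · exact huf t ⟨h0, ht.2⟩

/-! ### The semigroup property -/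

/-- The kernel `Φ_c` of the fractional integral, cut off outside `(0, T]`. -/
noncomputable def cutKernel (T c : ℝ) : ℝ → ℝ := indicator (Ioc 0 T) (Phi c)

theorem integrable_cutKernel {T c : ℝ} (hT : 0 ≤ T) (hc : 0 < c) :
    Integrable (cutKernel T c) := by
  rw [cutKernel, integrable_indicator_iff measurableSet_Ioc,
    ← intervalIntegrable_iff_integrableOn_Ioc_of_le hT]
  exact (intervalIntegral.intervalIntegrable_rpow' (by linarith)).div_const _

open ContinuousLinearMap in
-- The vanishing of `F` on `s ≤ 0` and of the kernel for `s ≥ t` restrict the convolution to `(0,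
-- t)`; the cut-off at `T` is invisible for `t ≤ T` and serves only to make the kernel integrable on
-- the line.
theorem convolution_cutKernel {T c t : ℝ} (hc : 0 < c) (ht : t ∈ Ioc 0 T) {F : ℝ → ℝ}
    (hF : ∀ s ≤ 0, F s = 0) :
    convolution F (cutKernel T c) (mul ℝ ℝ) volume t = rlInt c F t := by
  rw [rlInt_of_pos hc, intervalIntegral.integral_of_le ht.1.le, integral_Ioc_eq_integral_Ioo,
    ← integral_const_mul, ← integral_indicator measurableSet_Ioo]
  refine integral_congr_ae (Eventually.of_forall fun s => ?_)
  simp only [mul_apply']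
  by_cases h0 : s ≤ 0
  · rw [hF s h0, indicator_of_notMem (fun h => absurd h.1 (not_lt.2 h0)), zero_mul]
  by_cases h1 : t ≤ s
  · rw [cutKernel, indicator_of_notMem (fun h => by linarith [h.1]),
      indicator_of_notMem (fun h => absurd h.2 (not_lt.2 h1)), mul_zero]
  push Not at h0 h1
  rw [cutKernel, indicator_of_mem (by constructor <;> linarith [ht.2]),
    indicator_of_mem (show s ∈ Ioo 0 t from ⟨h0, h1⟩), Phi]
  ring

open ContinuousLinearMap in
theorem convolution_eq_zero_of_nonpos {F K : ℝ → ℝ} {t : ℝ} (ht : t ≤ 0)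
    (hF : ∀ s ≤ 0, F s = 0) (hK : ∀ s ≤ 0, K s = 0) :
    convolution F K (mul ℝ ℝ) volume t = 0 := by
  rw [convolution]
  refine integral_eq_zero_of_ae (Eventually.of_forall fun s => ?_)
  simp only [mul_apply', Pi.zero_apply]
  rcases le_or_gt s 0 with h0 | h0
  · rw [hF s h0, zero_mul]
  · rw [hK (t - s) (by linarith), mul_zero]

theorem cutKernel_of_nonpos {T c s : ℝ} (hs : s ≤ 0) : cutKernel T c s = 0 :=
  indicator_of_notMem (fun h => absurd h.1 (not_lt.2 hs)) _

open ContinuousLinearMap in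
-- This is associativity of convolution, together with `Φ_b * Φ_a = Φ_{a+b}` on `(0, T]`, which is
-- `rlInt_Phi`. The iterated convolution of the absolute values exists only almost everywhere, so
-- the identity is first obtained a.e.; both sides are continuous on `(0, T]`, which gives it
-- everywhere there.
theorem rlInt_rlInt_of_pos {T γ a b : ℝ} (hT : 0 < T) {f : ℝ → ℝ} (hf : MemC T γ f)
    (hγ : γ < 1) (ha : 0 < a) (hb : 0 < b) :
    EqOn (rlInt a (rlInt b f)) (rlInt (a + b) f) (Ioc 0 T) := by
  have hab : 0 < a + b := add_pos ha hb
  set w := indicator (Ioc 0 T) f with hw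
  have hwi : Integrable w := by
    rw [hw, integrable_indicator_iff measurableSet_Ioc,
      ← intervalIntegrable_iff_integrableOn_Ioc_of_le hT.le]
    exact hf.intervalIntegrable hγ ⟨hT.le, le_rfl⟩
  have hka := integrable_cutKernel hT.le ha
  have hkb := integrable_cutKernel hT.le hb
  have hw0 : ∀ s ≤ 0, w s = 0 := fun s hs =>
    indicator_of_notMem (fun h => absurd h.1 (not_lt.2 hs)) _
  have hwf : EqOn w f (Ioc 0 T) := fun s hs => indicator_of_mem hs _
  refine Measure.eqOn_Ioc_of_ae_eq (μ := volume) ?_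
    ((hf.rlInt hT.le hγ hb.le (le_of_lt (sub_lt_self γ hb))).rlInt hT.le hγ ha.le
      le_rfl).continuousOn
    (hf.rlInt hT.le hγ hab.le le_rfl).continuousOn
  rw [EventuallyEq, ae_restrict_iff' measurableSet_Ioc]
  have hex := hwi.norm.ae_convolution_exists (L := mul ℝ ℝ)
    (hkb.norm.integrable_convolution (mul ℝ ℝ) hka.norm)
  filter_upwards [hex] with t ht3 ht
  have h1 := convolution_assoc (mul ℝ ℝ) (mul ℝ ℝ) (mul ℝ ℝ) (mul ℝ ℝ)
    (fun x y z => by simp [mul_assoc]) (x₀ := t)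
    hwi.aestronglyMeasurable hkb.aestronglyMeasurable hka.aestronglyMeasurable
    (hwi.ae_convolution_exists (L := mul ℝ ℝ) hkb)
    (hkb.norm.ae_convolution_exists (L := mul ℝ ℝ) hka.norm) ht3
  have h2 : convolution (convolution w (cutKernel T b) (mul ℝ ℝ) volume) (cutKernel T a)
      (mul ℝ ℝ) volume t = rlInt a (rlInt b f) t := by
    rw [convolution_cutKernel ha ht fun s hs =>
      convolution_eq_zero_of_nonpos hs hw0 fun r hr => cutKernel_of_nonpos hr]
    refine rlInt_congr_Ioc ha.le (fun s hs => ?_) ht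
    rw [convolution_cutKernel hb hs hw0]
    exact rlInt_congr_Ioc hb.le hwf hs
  have h3 : convolution w (convolution (cutKernel T b) (cutKernel T a) (mul ℝ ℝ) volume)
      (mul ℝ ℝ) volume t = rlInt (a + b) f t := by
    rw [← rlInt_congr_Ioc hab.le hwf ht, ← convolution_cutKernel hab ht hw0]
    refine integral_congr_ae (Eventually.of_forall fun s => ?_)
    simp only [mul_apply']
    by_cases h0 : s ≤ 0
    · rw [hw0 s h0, zero_mul, zero_mul]
    congr 1
    by_cases h1 : t ≤ s
    · rw [cutKernel_of_nonpos (by linarith), convolution_eq_zero_of_nonpos (by linarith)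
        (fun r hr => cutKernel_of_nonpos hr) (fun r hr => cutKernel_of_nonpos hr)]
    push Not at h0 h1
    have hs : t - s ∈ Ioc 0 T := by constructor <;> linarith [ht.2]
    rw [convolution_cutKernel ha hs fun r hr => cutKernel_of_nonpos hr,
      rlInt_congr_Ioc ha.le (f := fun r => cutKernel T b r) (g := Phi b) (fun r hr => indicator_of_mem hr _) hs,
      rlInt_Phi ha.le hb hs.1, cutKernel, indicator_of_mem hs, add_comm]
  rw [← h2, ← h3, h1]

theorem rlInt_rlInt {T γ a b : ℝ} (hT : 0 < T) {f : ℝ → ℝ} (hf : MemC T γ f)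
    (hγ : γ < 1) (ha : 0 ≤ a) (hb : 0 ≤ b) :
    EqOn (rlInt a (rlInt b f)) (rlInt (a + b) f) (Ioc 0 T) := by
  rcases ha.eq_or_lt with rfl | ha
  · simp [rlInt_zero_left, EqOn]
  rcases hb.eq_or_lt with rfl | hb
  · simp [rlInt_zero_left, EqOn]
  exact rlInt_rlInt_of_pos hT hf hγ ha hb

/-! ### Differentiation of fractional integrals -/

theorem hasDerivWithinAt_primitive {T t : ℝ} {f : ℝ → ℝ} (hf : ContinuousOn f (Icc 0 T))
    (ht : t ∈ Icc 0 T) :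
    HasDerivWithinAt (fun x => ∫ s in (0 : ℝ)..x, f s) (f t) (Icc 0 T) t := by
  have hT : 0 ≤ T := ht.1.trans ht.2
  have hg : Continuous (IccExtend hT ((Icc 0 T).domRestrict f)) := hf.domRestrict.Icc_extend'
  have hgf : EqOn (IccExtend hT ((Icc 0 T).domRestrict f)) f (Icc 0 T) := fun x hx => by
    rw [IccExtend_of_mem _ _ hx]; rfl
  have h1 := (intervalIntegral.integral_hasDerivAt_right (hg.intervalIntegrable 0 t)
    (hg.stronglyMeasurableAtFilter _ _) hg.continuousAt).hasDerivWithinAt (s := Icc 0 T)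
  rw [hgf ht] at h1
  have h2 : ∀ x ∈ Icc 0 T, ∫ s in (0 : ℝ)..x, f s
      = ∫ s in (0 : ℝ)..x, IccExtend hT ((Icc 0 T).domRestrict f) s := fun x hx => by
    refine intervalIntegral.integral_congr fun s hs => ?_
    rw [uIcc_of_le hx.1] at hs
    exact (hgf ⟨hs.1, hs.2.trans hx.2⟩).symm
  exact h1.congr h2 (h2 t ht)

theorem hasDerivWithinAt_primitive_of_memC {T γ t : ℝ} {f : ℝ → ℝ} (hf : MemC T γ f) (hγ : γ < 1)
    (ht : t ∈ Ioc 0 T) :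
    HasDerivWithinAt (fun x => ∫ s in (0 : ℝ)..x, f s) (f t) (Icc 0 T) t := by
  have hT : 0 ≤ T := ht.1.le.trans ht.2
  -- The integrand may blow up at `0`: the integral is split at `r`, and the fundamental theorem is
  -- applied on `[r, T]` only.
  set r := t / 2 with hr
  have hr0 : 0 < r := half_pos ht.1
  have hrt : r < t := half_lt_self ht.1
  have hrT : r ≤ T := hrt.le.trans ht.2
  have hfr : ContinuousOn f (Icc r T) :=
    hf.continuousOn.mono fun x hx => ⟨hr0.trans_le hx.1, hx.2⟩
  have hg : Continuous (IccExtend hrT ((Icc r T).domRestrict f)) := hfr.domRestrict.Icc_extend'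
  have hgf : EqOn (IccExtend hrT ((Icc r T).domRestrict f)) f (Icc r T) := fun x hx => by
    rw [IccExtend_of_mem _ _ hx]; rfl
  have h1 := ((intervalIntegral.integral_hasDerivAt_right (hg.intervalIntegrable r t)
    (hg.stronglyMeasurableAtFilter _ _) hg.continuousAt).hasDerivWithinAt
      (s := Icc r T)).const_add (∫ s in (0 : ℝ)..r, f s)
  rw [hgf ⟨hrt.le, ht.2⟩] at h1
  have h2 : ∀ x ∈ Icc r T, ∫ s in (0 : ℝ)..x, f s = (∫ s in (0 : ℝ)..r, f s)
      + ∫ s in r..x, IccExtend hrT ((Icc r T).domRestrict f) s := fun x hx => by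
    have e1 : ∫ s in r..x, IccExtend hrT ((Icc r T).domRestrict f) s = ∫ s in r..x, f s := by
      refine intervalIntegral.integral_congr fun s hs => ?_
      rw [uIcc_of_le hx.1] at hs
      exact hgf ⟨hs.1, hs.2.trans hx.2⟩
    have i1 := hf.intervalIntegrable hγ (t := r) ⟨hr0.le, hrT⟩
    have i2 := hf.intervalIntegrable hγ (t := x) ⟨hr0.le.trans hx.1, hx.2⟩
    rw [e1, intervalIntegral.integral_add_adjacent_intervals i1 (i1.symm.trans i2)]
  have h3 := h1.congr h2 (h2 t ⟨hrt.le, ht.2⟩)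
  refine h3.mono_of_mem_nhdsWithin ?_
  rw [mem_nhdsWithin]
  exact ⟨Ioi r, isOpen_Ioi, hrt, fun x hx => ⟨hx.1.le, hx.2.2⟩⟩

theorem rlInt_add_one {T γ c : ℝ} (hT : 0 < T) {f : ℝ → ℝ} (hf : MemC T γ f) (hγ : γ < 1)
    (hc : 0 ≤ c) {t : ℝ} (ht : t ∈ Icc 0 T) :
    rlInt (c + 1) f t = ∫ s in (0 : ℝ)..t, rlInt c f s := by
  rcases ht.1.eq_or_lt with rfl | h0
  · simp [rlInt_apply_zero (by linarith : 0 < c + 1)]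
  rw [← rlInt_one, rlInt_rlInt hT hf hγ zero_le_one hc ⟨h0, ht.2⟩, add_comm]

theorem hasDerivWithinAt_rlInt {T γ c t : ℝ} {f : ℝ → ℝ} (hf : MemC T γ f) (hγ : γ < 1)
    (hc : 0 ≤ c) (ht : t ∈ Ioc 0 T) :
    HasDerivWithinAt (rlInt (c + 1) f) (rlInt c f t) (Icc 0 T) t := by
  have hT : 0 < T := ht.1.trans_le ht.2
  have h1 := hasDerivWithinAt_primitive_of_memC
    (hf.rlInt hT.le hγ hc (sub_le_self γ hc)) hγ ht
  exact h1.congr (fun x hx => rlInt_add_one hT hf hγ hc hx)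
    (rlInt_add_one hT hf hγ hc (Ioc_subset_Icc_self ht))

theorem hasDerivWithinAt_rlInt_Icc {T γ c t : ℝ} (hT : 0 < T) {f : ℝ → ℝ} (hf : MemC T γ f)
    (hγ : γ < 1) (hc : 0 < c) (hγc : γ < c) (ht : t ∈ Icc 0 T) :
    HasDerivWithinAt (rlInt (c + 1) f) (rlInt c f t) (Icc 0 T) t := by
  have h1 := hasDerivWithinAt_primitive (hf.continuousOn_rlInt hT.le hγ hc hγc) ht
  exact h1.congr (fun x hx => rlInt_add_one hT hf hγ hc.le hx)
    (rlInt_add_one hT hf hγ hc.le ht)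

/-! ### Chains of derivatives -/

/-- Iterated derivatives are identified by guessing all of them at once, each being the derivative
of the one before. -/
theorem eqOn_iteratedDerivWithin_of_chain {s : Set ℝ} (hs : UniqueDiffOn ℝ s) {p : ℕ}
    {F : ℕ → ℝ → ℝ} {f : ℝ → ℝ} (hf : EqOn f (F 0) s)
    (hF : ∀ k < p, ∀ t ∈ s, HasDerivWithinAt (F k) (F (k + 1) t) s t) :
    ∀ k ≤ p, EqOn (iteratedDerivWithin k f s) (F k) s := by
  intro k
  induction k with
  | zero => intro _; rwa [iteratedDerivWithin_zero]
  | succ k ih =>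
    intro hk t ht
    have h1 := ih (by omega)
    rw [iteratedDerivWithin_succ, derivWithin_congr h1 (h1 ht)]
    exact (hF k (by omega) t ht).derivWithin (hs t ht)

/-! ### The functions `Φ_β` -/

theorem Phi_natCast_add_one (k : ℕ) (t : ℝ) : Phi (k + 1) t = t ^ k / (k.factorial : ℝ) := by
  rw [Phi, add_sub_cancel_right, Real.rpow_natCast, Real.Gamma_nat_eq_factorial]

theorem Phi_one (t : ℝ) : Phi 1 t = 1 := by
  simp [Phi]

theorem Phi_apply_zero {β : ℝ} (hβ : 1 < β) : Phi β 0 = 0 := by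
  rw [Phi, Real.zero_rpow (by linarith), zero_div]

theorem continuous_Phi {β : ℝ} (hβ : 1 ≤ β) : Continuous (Phi β) :=
  (Real.continuous_rpow_const (by linarith)).div_const _

theorem hasDerivAt_Phi {β : ℝ} (hβ : 1 ≤ β) (t : ℝ) : HasDerivAt (Phi (β + 1)) (Phi β t) t := by
  have h1 := (Real.hasDerivAt_rpow_const (x := t) (p := β) (Or.inr hβ)).div_const
    (Real.Gamma (β + 1))
  have hβ0 : β ≠ 0 := by linarith
  have hG : Real.Gamma β ≠ 0 := (Real.Gamma_pos_of_pos (by linarith)).ne'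
  have h2 : (fun x : ℝ => x ^ β / Real.Gamma (β + 1)) = Phi (β + 1) := by
    funext x; rw [Phi, add_sub_cancel_right]
  rw [h2] at h1
  have h3 : Phi β t = β * t ^ (β - 1) / Real.Gamma (β + 1) := by
    rw [Phi, Real.Gamma_add_one hβ0]
    field_simp
  rw [h3]
  exact h1

/-- The function `∑ j ∈ [p, n), b j * Φ_{j+1-α}`; for `p = ⌈α⌉` it is the Caputo derivative of
order `α` of the polynomial with the initial data `b 0, …, b (n - 1)`. -/
noncomputable def polyPart (b : ℕ → ℝ) (n p : ℕ) (α : ℝ) (t : ℝ) : ℝ :=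
  ∑ j ∈ Finset.Ico p n, b j * Phi (j + 1 - α) t

theorem one_le_of_mem_Ico {p n j : ℕ} {α : ℝ} (hα : α ≤ p) (hj : j ∈ Finset.Ico p n) :
    (1 : ℝ) ≤ j + 1 - α := by
  have : (p : ℝ) ≤ j := by exact_mod_cast (Finset.mem_Ico.1 hj).1
  linarith

theorem continuous_polyPart {b : ℕ → ℝ} {n p : ℕ} {α : ℝ} (hα : α ≤ p) :
    Continuous (polyPart b n p α) :=
  continuous_finsetSum _ fun _ hj =>
    continuous_const.mul (continuous_Phi (one_le_of_mem_Ico hα hj))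

theorem hasDerivAt_polyPart {b : ℕ → ℝ} {n p : ℕ} {α : ℝ} (hα : α ≤ p) (t : ℝ) :
    HasDerivAt (polyPart b n p (α - 1)) (polyPart b n p α t) t := by
  unfold polyPart
  refine HasDerivAt.fun_sum fun j hj => ?_
  have h1 := hasDerivAt_Phi (one_le_of_mem_Ico hα hj) t
  rw [show (j : ℝ) + 1 - (α - 1) = j + 1 - α + 1 by ring]
  exact h1.const_mul _

theorem polyPart_of_le {b : ℕ → ℝ} {n p : ℕ} (hp : n ≤ p) (α t : ℝ) : polyPart b n p α t = 0 := by
  rw [polyPart, Finset.Ico_eq_empty_of_le hp, Finset.sum_empty]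

theorem polyPart_eq_add {b : ℕ → ℝ} {n p : ℕ} (hp : p < n) (α t : ℝ) :
    polyPart b n p α t = b p * Phi (p + 1 - α) t + polyPart b n (p + 1) α t := by
  rw [polyPart, polyPart, Finset.sum_eq_sum_Ico_succ_bot hp]

/-- At integer order the lowest term is the constant `b k * Φ_1`, which differentiation kills; hence
the lower index moves along with the order. -/
theorem hasDerivAt_polyPart_nat (b : ℕ → ℝ) (n k : ℕ) (t : ℝ) :
    HasDerivAt (polyPart b n k k) (polyPart b n (k + 1) ((k + 1 : ℕ) : ℝ) t) t := by
  rcases Nat.lt_or_ge k n with hk | hk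
  · have h1 := (hasDerivAt_polyPart (b := b) (n := n) (p := k + 1) le_rfl t).const_add (b k)
    refine h1.congr_of_eventuallyEq (Eventually.of_forall fun x => ?_)
    rw [polyPart_eq_add hk]
    push_cast
    simp [Phi_one]
  · rw [polyPart_of_le (by omega)]
    refine (hasDerivAt_const t (0 : ℝ)).congr_of_eventuallyEq (Eventually.of_forall fun x => ?_)
    exact polyPart_of_le hk _ _

theorem polyPart_nat_apply_zero {b : ℕ → ℝ} {n k : ℕ} (hk : k < n) :
    polyPart b n k k 0 = b k := by
  rw [polyPart_eq_add hk, polyPart, Finset.sum_eq_zero]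
  · simp [Phi_one]
  · intro j hj
    have : (k : ℝ) + 1 ≤ j := by exact_mod_cast (Finset.mem_Ico.1 hj).1
    rw [Phi_apply_zero (by linarith), mul_zero]

theorem rlInt_polyPart {b : ℕ → ℝ} {n p : ℕ} {α c t : ℝ} (hα : α ≤ p) (hc : 0 ≤ c) (ht : 0 < t) :
    rlInt c (polyPart b n p α) t = polyPart b n p (α - c) t := by
  unfold polyPart
  rw [rlInt_sum (T := t) (γ := 0) _ (f := fun j s => b j * Phi (j + 1 - α) s) (fun j hj => memC_zero_of_continuousOn
    (continuous_const.mul (continuous_Phi (one_le_of_mem_Ico hα hj))).continuousOn) one_pos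
    hc ⟨ht.le, le_rfl⟩]
  refine Finset.sum_congr rfl fun j hj => ?_
  rw [rlInt_const_mul, rlInt_Phi hc (by linarith [one_le_of_mem_Ico hα hj]) ht,
    show (j : ℝ) + 1 - α + c = j + 1 - (α - c) by ring]

/-! ### Caputo derivatives -/

/-- Subtracting the Taylor polynomial removes exactly the terms of index below `⌈α⌉`. Applying
`I^{⌈α⌉-α}` raises all orders by `⌈α⌉ - α`, by the semigroup law, and the `⌈α⌉` derivatives lower
them again one at a time. -/
theorem caputo_polyPart_add_rlInt {T γ α σ : ℝ} {b : ℕ → ℝ} {n : ℕ} {f y : ℝ → ℝ} (hT : 0 < T)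
    (hf : MemC T γ f) (hγ : γ < 1) (hασ : α ≤ σ) (hα : 0 ≤ α) (hp : ⌈α⌉₊ ≤ n)
    (hy : EqOn y (fun t => polyPart b n 0 0 t + rlInt σ f t) (Ioc 0 T))
    (hb : ∀ k < ⌈α⌉₊, iteratedDerivWithin k y (Icc 0 T) 0 = b k) :
    ∀ t ∈ Ioc 0 T, CaputoExistsAt T α y t ∧
      caputo T α y t = rlInt (σ - α) f t + polyPart b n ⌈α⌉₊ α t := by
  set p := ⌈α⌉₊ with hpdef
  have hαp : α ≤ p := Nat.le_ceil α
  have hσ : 0 ≤ σ := hα.trans hασ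
  have hrem : EqOn (taylorRemainder T p y) (fun t => polyPart b n p 0 t + rlInt σ f t)
      (Ioc 0 T) := by
    intro t ht
    have h1 : polyPart b n 0 0 t = (∑ k ∈ Finset.range p,
        iteratedDerivWithin k y (Icc 0 T) 0 / (k.factorial : ℝ) * t ^ k) + polyPart b n p 0 t := by
      rw [polyPart, polyPart, ← Finset.sum_Ico_consecutive _ (Nat.zero_le p) hp,
        Nat.Ico_zero_eq_range]
      congr 1
      refine Finset.sum_congr rfl fun k hk => ?_
      rw [hb k (Finset.mem_range.1 hk), sub_zero, Phi_natCast_add_one]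
      ring
    simp only [taylorRemainder, hy ht, h1]
    ring
  -- The expected `k`-th derivative of `I^{p-α}` of the remainder.
  let F : ℕ → ℝ → ℝ := fun k t =>
    polyPart b n p (α - (p - k)) t + rlInt (σ - α + (p - k)) f t
  have hF0 : EqOn (rlInt (p - α) (taylorRemainder T p y)) (F 0) (Ioc 0 T) := by
    intro t ht
    have hpα : 0 ≤ (p : ℝ) - α := sub_nonneg.2 hαp
    -- The exponent `γ` may be negative, whereas the polynomial part lies in the space of weight
    -- `0`; `max γ 0` serves both.
    have hδ : max γ 0 < 1 := max_lt hγ one_pos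
    have hp0 : (0 : ℝ) ≤ p := Nat.cast_nonneg p
    have hP : MemC T (max γ 0) (polyPart b n p 0) :=
      (memC_zero_of_continuousOn (continuous_polyPart hp0).continuousOn).mono (le_max_right _ _)
    have hI : MemC T (max γ 0) (rlInt σ f) :=
      hf.rlInt hT.le hγ hσ ((sub_le_self γ hσ).trans (le_max_left _ _))
    rw [rlInt_congr_Ioc hpα hrem ht, rlInt_add hP hI hδ hpα (Ioc_subset_Icc_self ht),
      rlInt_polyPart hp0 hpα ht.1, rlInt_rlInt hT hf hγ hpα hσ ht]
    simp only [F]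
    congr 2
    · simp
    · simp; ring
  have hF : ∀ k < p, ∀ t ∈ Ioc 0 T, HasDerivWithinAt (F k) (F (k + 1) t) (Ioc 0 T) t := by
    intro k hk t ht
    have hk' : (k : ℝ) + 1 ≤ p := by exact_mod_cast hk
    have h1 := (hasDerivAt_polyPart (b := b) (n := n) (p := p) (α := α - (p - (k + 1)))
      (by linarith) t).hasDerivWithinAt (s := Ioc 0 T)
    have h2 := (hasDerivWithinAt_rlInt (c := σ - α + (p - (k + 1))) hf hγ (by linarith) ht).mono
      Ioc_subset_Icc_self
    rw [show α - (p - ((k : ℝ) + 1)) - 1 = α - (p - k) by ring] at h1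
    rw [show σ - α + (p - ((k : ℝ) + 1)) + 1 = σ - α + (p - k) by ring] at h2
    have h3 := h1.add h2
    simp only [F]
    push_cast
    exact h3
  have hchain := eqOn_iteratedDerivWithin_of_chain (uniqueDiffOn_Ioc 0 T) hF0 hF
  intro t ht
  refine ⟨fun k hk => ?_, ?_⟩
  · exact ((hF k hk t ht).differentiableWithinAt).congr (hchain k hk.le) (hchain k hk.le ht)
  · rw [caputo, rlDeriv, ← hpdef, hchain p le_rfl ht]
    simp only [F]
    rw [sub_self, sub_zero, add_zero, add_comm]

/-! ### Regularity and Taylor's formula -/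

theorem iteratedDerivWithin_polyPart_add_rlInt {T γ σ : ℝ} {b : ℕ → ℝ} {n N : ℕ} {f y : ℝ → ℝ}
    (hT : 0 < T) (hf : MemC T γ f) (hγ0 : 0 ≤ γ) (hγ : γ < 1) (hσ : γ + N < σ)
    (hy : EqOn y (fun t => polyPart b n 0 0 t + rlInt σ f t) (Icc 0 T)) :
    ∀ k ≤ N, EqOn (iteratedDerivWithin k y (Icc 0 T))
      (fun t => polyPart b n k k t + rlInt (σ - k) f t) (Icc 0 T) := by
  refine eqOn_iteratedDerivWithin_of_chain (uniqueDiffOn_Icc hT)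
    (F := fun k t => polyPart b n k k t + rlInt (σ - k) f t) (by simpa using hy) ?_
  intro k hk t ht
  have hk' : (k : ℝ) + 1 ≤ N := by exact_mod_cast hk
  have h1 := (hasDerivAt_polyPart_nat b n k t).hasDerivWithinAt (s := Icc 0 T)
  have h2 := hasDerivWithinAt_rlInt_Icc (c := σ - (k + 1)) hT hf hγ (by linarith) (by linarith) ht
  rw [show σ - ((k : ℝ) + 1) + 1 = σ - k by ring] at h2
  have h3 := h1.add h2
  push_cast at h3 ⊢
  exact h3

/-- Downward induction on `k` from the trivial case `k = N + 1`: the difference of the two sides is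
continuous on `[0, T]`, vanishes at `0`, and has derivative zero inside by the case `k + 1`. -/
theorem iteratedDerivWithin_eqOn_taylor {T γ : ℝ} {N : ℕ} {z : ℝ → ℝ} (hT : 0 < T) (hγ : γ < 1)
    (hz : MemCn T γ (N + 1) z) (k : ℕ) (hk : k ≤ N + 1) :
    EqOn (iteratedDerivWithin k z (Icc 0 T))
      (fun t => polyPart (fun j => iteratedDerivWithin j z (Icc 0 T) 0) (N + 1) k k t
        + rlInt ((N + 1 : ℕ) - k) (iteratedDerivWithin (N + 1) z (Icc 0 T)) t) (Ioc 0 T) := by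
  obtain ⟨hz1, hz2, hz3⟩ := hz
  set w := iteratedDerivWithin (N + 1) z (Icc 0 T) with hw
  set b : ℕ → ℝ := fun j => iteratedDerivWithin j z (Icc 0 T) 0 with hb
  have hU := uniqueDiffOn_Icc hT
  have hz4 : ∀ k ≤ N, ∀ t ∈ Ioo 0 T, HasDerivAt (iteratedDerivWithin k z (Icc 0 T))
      (iteratedDerivWithin (k + 1) z (Icc 0 T) t) t := by
    intro k hk t ht
    have hd : DifferentiableWithinAt ℝ (iteratedDerivWithin k z (Icc 0 T)) (Icc 0 T) t := by
      rcases hk.eq_or_lt with rfl | hk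
      · exact hz2 t (Ioo_subset_Ioc_self ht)
      · exact hz1.differentiableOn_iteratedDerivWithin (by exact_mod_cast hk) hU t
          (Ioo_subset_Icc_self ht)
    have := hd.hasDerivWithinAt
    rw [← iteratedDerivWithin_succ] at this
    exact this.hasDerivAt (Icc_mem_nhds ht.1 ht.2)
  induction hk using Nat.decreasingInduction with
  | self =>
    intro t ht
    simp only [sub_self, rlInt_zero_left]
    rw [polyPart_of_le le_rfl, zero_add]
  | of_succ k hk ih =>
    have hkN : k ≤ N := by omega
    have hk' : (k : ℝ) ≤ N := by exact_mod_cast hkN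
    set D : ℝ → ℝ := fun t => iteratedDerivWithin k z (Icc 0 T) t
      - (polyPart b (N + 1) k k t + rlInt ((N + 1 : ℕ) - k) w t) with hD
    have hc : (0 : ℝ) < (N + 1 : ℕ) - k := by push_cast; linarith
    have hDc : ContinuousOn D (Icc 0 T) := by
      refine ContinuousOn.sub ?_ (ContinuousOn.add (continuous_polyPart le_rfl).continuousOn ?_)
      · exact hz1.continuousOn_iteratedDerivWithin (by exact_mod_cast hkN) hU
      · exact hz3.continuousOn_rlInt hT.le hγ hc (by push_cast; linarith)
    have hD' : ∀ t ∈ Ioo 0 T, HasDerivAt D 0 t := by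
      intro t ht
      have h1 := hz4 k hkN t ht
      have h2 := hasDerivAt_polyPart_nat b (N + 1) k t
      have h3 := (hasDerivWithinAt_rlInt (c := (N + 1 : ℕ) - (k + 1 : ℕ)) hz3 hγ
        (by push_cast; linarith) (Ioo_subset_Ioc_self ht)).hasDerivAt (Icc_mem_nhds ht.1 ht.2)
      rw [show ((N + 1 : ℕ) : ℝ) - (k + 1 : ℕ) + 1 = (N + 1 : ℕ) - k by push_cast; ring] at h3
      have h4 := h1.sub (h2.add h3)
      rw [ih (Ioo_subset_Ioc_self ht), sub_self] at h4
      exact h4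
    have hD0 : D 0 = 0 := by
      simp only [hD]
      rw [rlInt_apply_zero hc, polyPart_nat_apply_zero (by omega)]
      simp [hb]
    intro t ht
    have h5 := intervalIntegral.integral_eq_sub_of_hasDerivAt_of_le (f' := fun _ => 0) ht.1.le
      (hDc.mono (Icc_subset_Icc_right ht.2)) (fun x hx => hD' x ⟨hx.1, hx.2.trans_le ht.2⟩)
      (by simp)
    rw [hD0, intervalIntegral.integral_zero, sub_zero] at h5
    exact sub_eq_zero.1 h5.symm

theorem eqOn_taylor {T γ : ℝ} {N : ℕ} {z : ℝ → ℝ} (hT : 0 < T) (hγ : γ < 1)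
    (hz : MemCn T γ (N + 1) z) :
    EqOn z (fun t => polyPart (fun j => iteratedDerivWithin j z (Icc 0 T) 0) (N + 1) 0 0 t
        + rlInt (N + 1 : ℕ) (iteratedDerivWithin (N + 1) z (Icc 0 T)) t) (Icc 0 T) := by
  intro t ht
  rcases ht.1.eq_or_lt with rfl | h0
  · have := polyPart_nat_apply_zero (b := fun j => iteratedDerivWithin j z (Icc 0 T) 0)
      (Nat.succ_pos N)
    simp only [Nat.cast_zero] at this
    simp only
    rw [this, rlInt_apply_zero (by positivity)]
    simp
  · simpa using iteratedDerivWithin_eqOn_taylor hT hγ hz 0 (Nat.zero_le _) ⟨h0, ht.2⟩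

/-! ### Functions with a continuous Euler derivative -/

/-- `u` is continuous on `[0, T]`, and so is its Euler derivative `v t = t * u' t`. -/
structure EulerPair (T : ℝ) (u v : ℝ → ℝ) : Prop where
  continuousOn : ContinuousOn u (Icc 0 T)
  continuousOn_euler : ContinuousOn v (Icc 0 T)
  hasDerivAt : ∀ t ∈ Ioo 0 T, HasDerivAt u (v t / t) t

namespace EulerPair

theorem zero (T : ℝ) : EulerPair T (fun _ => 0) (fun _ => 0) :=
  ⟨continuousOn_const, continuousOn_const, fun t _ => by simpa using hasDerivAt_const t (0 : ℝ)⟩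

theorem add {T : ℝ} {u v u' v' : ℝ → ℝ} (hu : EulerPair T u v) (hu' : EulerPair T u' v') :
    EulerPair T (fun t => u t + u' t) (fun t => v t + v' t) :=
  ⟨hu.1.add hu'.1, hu.2.add hu'.2, fun t ht => by
    simpa only [add_div] using (hu.3 t ht).fun_add (hu'.3 t ht)⟩

theorem const_mul {T : ℝ} {u v : ℝ → ℝ} (hu : EulerPair T u v) (k : ℝ) :
    EulerPair T (fun t => k * u t) (fun t => k * v t) :=
  ⟨hu.1.const_smul k, hu.2.const_smul k, fun t ht => by
    simpa only [mul_div_assoc] using (hu.3 t ht).const_mul k⟩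

theorem mul {T : ℝ} {u v u' v' : ℝ → ℝ} (hu : EulerPair T u v) (hu' : EulerPair T u' v') :
    EulerPair T (fun t => u t * u' t) (fun t => v t * u' t + u t * v' t) :=
  ⟨hu.1.mul hu'.1, (hu.2.mul hu'.1).add (hu.1.mul hu'.2), fun t ht => by
    have := (hu.3 t ht).mul (hu'.3 t ht)
    convert! this using 1
    ring⟩

theorem sum {T : ℝ} {ι : Type*} (s : Finset ι) {u v : ι → ℝ → ℝ}
    (hu : ∀ i ∈ s, EulerPair T (u i) (v i)) :
    EulerPair T (fun t => ∑ i ∈ s, u i t) (fun t => ∑ i ∈ s, v i t) := by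
  classical
  induction s using Finset.induction_on with
  | empty => simpa using zero T
  | insert i s hi ih =>
    simp only [Finset.sum_insert hi]
    exact (hu i (by simp)).add (ih fun j hj => hu j (by simp [hj]))

theorem Phi {T β : ℝ} (hβ : 1 ≤ β) :
    EulerPair T (CaputoFDE.Phi β) (fun t => (β - 1) * CaputoFDE.Phi β t) := by
  refine ⟨(continuous_Phi hβ).continuousOn,
    (continuous_const.mul (continuous_Phi hβ)).continuousOn, fun t ht => ?_⟩
  have h1 := (Real.hasDerivAt_rpow_const (x := t) (p := β - 1) (Or.inl ht.1.ne')).div_const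
    (Real.Gamma β)
  have h2 : (β - 1) * CaputoFDE.Phi β t / t = (β - 1) * t ^ (β - 1 - 1) / Real.Gamma β := by
    rw [CaputoFDE.Phi, Real.rpow_sub_one ht.1.ne' (β - 1)]
    ring
  rw [h2]
  exact h1

/-- The Euler derivative is `t a' = t^(1-γ) (t^γ a')`, continuous up to `0` because `γ < 1`. -/
theorem of_memCn {T γ : ℝ} {a : ℝ → ℝ} (hγ : γ < 1) (ha : MemCn T γ 1 a) :
    ∃ a' : ℝ → ℝ, EulerPair T a a' := by
  obtain ⟨h1, h2, g, hg, hga⟩ := ha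
  refine ⟨fun t => t ^ (1 - γ) * g t, h1.continuousOn,
    (Real.continuous_rpow_const (by linarith)).continuousOn.mul hg, fun t ht => ?_⟩
  have h3 := h2 t (Ioo_subset_Ioc_self ht)
  rw [iteratedDerivWithin_zero] at h3
  have h4 := h3.hasDerivWithinAt.hasDerivAt (Icc_mem_nhds ht.1 ht.2)
  have h5 : t ^ (1 - γ) * g t / t = derivWithin a (Icc 0 T) t := by
    have h6 : g t = t ^ γ * iteratedDerivWithin 1 a (Icc 0 T) t := hga t (Ioo_subset_Ioc_self ht)
    rw [h6, iteratedDerivWithin_one, ← mul_assoc,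
      ← Real.rpow_add ht.1, sub_add_cancel, Real.rpow_one]
    field_simp [ht.1.ne']
  rw [h5]
  exact h4

/-- Differentiation under the integral in the scaled form: `t^c` contributes `c I^c u`, and `u(tx)`
contributes `I^c v`, since `x u'(tx) = v(tx) / t`. -/
theorem rlInt {T c : ℝ} {u v : ℝ → ℝ} (hT : 0 < T) (hc : 0 < c) (hu : EulerPair T u v) :
    EulerPair T (rlInt c u) (fun t => c * CaputoFDE.rlInt c u t + CaputoFDE.rlInt c v t) := by
  have hu0 := memC_zero_of_continuousOn hu.1
  have hv0 := memC_zero_of_continuousOn hu.2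
  have hcu := hu0.continuousOn_rlInt hT.le one_pos hc hc
  have hcv := hv0.continuousOn_rlInt hT.le one_pos hc hc
  refine ⟨hcu, (hcu.const_smul c).add hcv, fun t ht => ?_⟩
  obtain ⟨C, hC⟩ := isCompact_Icc.exists_bound_of_continuousOn hu.2
  have hmem : ∀ s ∈ Ioo 0 T, ∀ x ∈ Ioc (0 : ℝ) 1, s * x ∈ Ioo 0 T := fun s hs x hx =>
    ⟨mul_pos hs.1 hx.1, (mul_le_of_le_one_right hs.1.le hx.2).trans_lt hs.2⟩
  have hmeas : ∀ {f : ℝ → ℝ}, ContinuousOn f (Icc 0 T) → ∀ s ∈ Ioo 0 T,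
      AEStronglyMeasurable (fun x : ℝ => f (s * x)) (volume.restrict (Ioc 0 1)) := by
    intro f hf s hs
    refine ContinuousOn.aestronglyMeasurable ?_ measurableSet_Ioc
    exact hf.comp (by fun_prop) fun x hx => Ioo_subset_Icc_self (hmem s hs x hx)
  have hk : Measurable fun x : ℝ => (1 - x) ^ (c - 1) := by fun_prop
  have hkint : IntervalIntegrable (fun x : ℝ => (1 - x) ^ (c - 1)) volume 0 1 := by
    simpa using intervalIntegrable_beta hc one_pos
  -- Staying above `t / 2` bounds the factor `1 / s` in the derivative `v (s * x) / s` uniformly in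
  -- `x`.
  have hnhds : Ioo (t / 2) T ∈ 𝓝 t := Ioo_mem_nhds (half_lt_self ht.1) ht.2
  have hsub : Ioo (t / 2) T ⊆ Ioo 0 T := Ioo_subset_Ioo_left (half_pos ht.1).le
  obtain ⟨Cu, hCu⟩ := isCompact_Icc.exists_bound_of_continuousOn hu.1
  have key := (intervalIntegral.hasDerivAt_integral_of_dominated_loc_of_deriv_le
    (μ := volume) (a := 0) (b := 1)
    (F := fun s x => (1 - x) ^ (c - 1) * u (s * x))
    (F' := fun s x => (1 - x) ^ (c - 1) * (v (s * x) / s)) (x₀ := t)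
    (bound := fun x => (1 - x) ^ (c - 1) * (C / (t / 2))) hnhds ?_ ?_ ?_ ?_
    (hkint.mul_const _) ?_).2
  · have h1 : ∀ s ∈ Ioo 0 T, CaputoFDE.rlInt c u s
        = s ^ c * (1 / Real.Gamma c * ∫ x in (0 : ℝ)..1, (1 - x) ^ (c - 1) * u (s * x)) :=
      fun s hs => rlInt_eq_scaled hc hs.1 u
    have h2 := (Real.hasDerivAt_rpow_const (x := t) (p := c) (Or.inl ht.1.ne')).mul
      (key.const_mul (1 / Real.Gamma c))
    have h3 : HasDerivAt (CaputoFDE.rlInt c u) _ t := h2.congr_of_eventuallyEq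
      (Filter.eventuallyEq_of_mem (Ioo_mem_nhds ht.1 ht.2) h1)
    have h4 : ∫ x in (0 : ℝ)..1, (1 - x) ^ (c - 1) * (v (t * x) / t)
        = (∫ x in (0 : ℝ)..1, (1 - x) ^ (c - 1) * v (t * x)) / t := by
      rw [← intervalIntegral.integral_div]
      simp only [mul_div_assoc]
    convert! h3 using 1
    rw [h4, h1 t ht, rlInt_eq_scaled hc ht.1 v, Real.rpow_sub_one ht.1.ne']
    ring
  · filter_upwards [hnhds] with s hs
    rw [uIoc_of_le zero_le_one]
    exact hk.aestronglyMeasurable.mul (hmeas hu.1 s (hsub hs))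
  · rw [intervalIntegrable_iff, uIoc_of_le zero_le_one]
    refine Integrable.mono' ((intervalIntegrable_iff_integrableOn_Ioc_of_le zero_le_one).1
      (hkint.mul_const Cu)) (hk.aestronglyMeasurable.mul (hmeas hu.1 t ht)) ?_
    rw [ae_restrict_iff' measurableSet_Ioc]
    filter_upwards with x hx
    have hp : 0 ≤ (1 - x) ^ (c - 1) := Real.rpow_nonneg (by linarith [hx.2]) _
    rw [norm_mul, Real.norm_of_nonneg hp]
    exact mul_le_mul_of_nonneg_left (hCu _ (Ioo_subset_Icc_self (hmem t ht x hx))) hp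
  · rw [uIoc_of_le zero_le_one]
    exact hk.aestronglyMeasurable.mul ((hmeas hu.2 t ht).mul_const t⁻¹)
  · filter_upwards with x hx s hs
    rw [uIoc_of_le zero_le_one] at hx
    have hp : 0 ≤ (1 - x) ^ (c - 1) := Real.rpow_nonneg (by linarith [hx.2]) _
    have hb := hC _ (Ioo_subset_Icc_self (hmem s (hsub hs) x hx))
    have hs0 : 0 < s := (hsub hs).1
    rw [norm_mul, Real.norm_of_nonneg hp, norm_div, Real.norm_of_nonneg hs0.le]
    exact mul_le_mul_of_nonneg_left
      (div_le_div₀ ((norm_nonneg _).trans hb) hb (half_pos ht.1) hs.1.le) hp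
  · filter_upwards with x hx s hs
    rw [uIoc_of_le zero_le_one] at hx
    have h1 := hu.3 _ (hmem s (hsub hs) x hx)
    have h2 := (h1.comp s ((hasDerivAt_id s).mul_const x)).const_mul ((1 - x) ^ (c - 1))
    have hs0 : s ≠ 0 := (hsub hs).1.ne'
    have hx0 : x ≠ 0 := hx.1.ne'
    have h3 : v (s * x) / (s * x) * (1 * x) = v (s * x) / s := by field_simp
    simp only [id, Function.comp_def] at h2
    rw [h3] at h2
    exact h2

/-- An Euler pair prescribes the derivative only inside the interval; at `T` it follows from the
limit of the derivative from the left. -/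
theorem hasDerivWithinAt {T : ℝ} {u v : ℝ → ℝ} (hu : EulerPair T u v) {t : ℝ}
    (ht : t ∈ Ioc 0 T) : HasDerivWithinAt u (v t / t) (Icc 0 T) t := by
  rcases ht.2.eq_or_lt with rfl | h1
  · have hnhds : Ioo 0 t ∈ 𝓝[<] t := Ioo_mem_nhdsLT ht.1
    refine (hasDerivWithinAt_Iic_of_tendsto_deriv (s := Ioo 0 t)
      (fun x hx => (hu.3 x hx).differentiableAt.differentiableWithinAt)
      ((hu.1 t ⟨ht.1.le, le_rfl⟩).mono Ioo_subset_Icc_self) hnhds ?_).mono Icc_subset_Iic_self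
    have h2 : Tendsto (fun x => v x / x) (𝓝[Ioo 0 t] t) (𝓝 (v t / t)) :=
      ((hu.2 t ⟨ht.1.le, le_rfl⟩).mono Ioo_subset_Icc_self).div
        continuousWithinAt_id ht.1.ne'
    rw [nhdsWithin_Ioo_eq_nhdsLT ht.1] at h2
    refine h2.congr' ?_
    filter_upwards [hnhds] with x hx
    exact (hu.3 x hx).deriv.symm
  · exact (hu.3 t ⟨ht.1, h1⟩).hasDerivWithinAt

/-- The derivatives `vs N t / t` converge uniformly away from `0`, which suffices for
differentiability at each interior point. -/
theorem of_tendstoUniformlyOn {T : ℝ} {u v : ℝ → ℝ} {us vs : ℕ → ℝ → ℝ}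
    (hs : ∀ N, EulerPair T (us N) (vs N)) (hu : TendstoUniformlyOn us u atTop (Icc 0 T))
    (hv : TendstoUniformlyOn vs v atTop (Icc 0 T)) : EulerPair T u v := by
  refine ⟨hu.continuousOn (Eventually.of_forall fun N => (hs N).1).frequently,
    hv.continuousOn (Eventually.of_forall fun N => (hs N).2).frequently, fun t ht => ?_⟩
  have hsub : Ioo (t / 2) T ⊆ Ioo 0 T := Ioo_subset_Ioo_left (half_pos ht.1).le
  refine hasDerivAt_of_tendstoUniformlyOn (l := atTop) (f := us) (f' := fun N x => vs N x / x)
    (s := Ioo (t / 2) T) (g' := fun x => v x / x) isOpen_Ioo ?_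
    (Eventually.of_forall fun N x hx => (hs N).3 x (hsub hx))
    (fun x hx => hu.tendsto_at (Ioo_subset_Icc_self (hsub hx))) ⟨half_lt_self ht.1, ht.2⟩
  rw [Metric.tendstoUniformlyOn_iff] at hv ⊢
  intro ε hε
  filter_upwards [hv (ε * (t / 2)) (mul_pos hε (half_pos ht.1))] with N hN x hx
  have hx0 : 0 < x := (hsub hx).1
  have h1 := hN x (Ioo_subset_Icc_self (hsub hx))
  rw [Real.dist_eq] at h1 ⊢
  rw [← sub_div, abs_div, abs_of_pos hx0, div_lt_iff₀ hx0]
  exact h1.trans_le (mul_le_mul_of_nonneg_left hx.1.le hε.le)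

end EulerPair

/-! ### Uniform convergence and the fractional integral -/

/-- The integral `I^c` produces a factor `t^c`, so a negative weight down to `δ = -c` is harmless.
That extreme case is the one needed for the top derivative in the weighted norm. -/
theorem tendstoUniformlyOn_rpow_mul_rlInt {T c δ : ℝ} (hc : 0 < c) (hδ : 0 ≤ c + δ)
    {F : ℕ → ℝ → ℝ} {f : ℝ → ℝ} (hF : ∀ N, ContinuousOn (F N) (Icc 0 T))
    (hf : ContinuousOn f (Icc 0 T)) (hFf : TendstoUniformlyOn F f atTop (Icc 0 T)) :
    TendstoUniformlyOn (fun N t => t ^ δ * rlInt c (F N) t) (fun t => t ^ δ * rlInt c f t) atTop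
      (Ioc 0 T) := by
  rw [Metric.tendstoUniformlyOn_iff] at hFf ⊢
  intro ε hε
  set K := Real.Gamma 1 / Real.Gamma (c + 1) * T ^ (c + δ) with hK
  rcases le_or_gt T 0 with hT | hT
  · exact Eventually.of_forall fun N t ht => absurd (ht.1.trans_le ht.2) (not_lt.2 hT)
  have hR0 : 0 < Real.Gamma 1 / Real.Gamma (c + 1) :=
    div_pos (Real.Gamma_pos_of_pos one_pos) (Real.Gamma_pos_of_pos (by linarith))
  have hK0 : 0 < K := mul_pos hR0 (Real.rpow_pos_of_pos hT _)
  filter_upwards [hFf (ε / (2 * K)) (by positivity)] with N hN t ht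
  have ht' := Ioc_subset_Icc_self ht
  have h1 : |rlInt c (fun s => f s - F N s) t|
      ≤ ε / (2 * K) * (Real.Gamma 1 / Real.Gamma (c + 1) * t ^ (c + 1 - 1)) := by
    refine abs_rlInt_le hc one_pos ht.1 fun s hs => ?_
    have h2 := hN s ⟨hs.1.le, hs.2.le.trans ht.2⟩
    rw [Real.dist_eq] at h2
    simpa using h2.le
  rw [rlInt_sub (memC_zero_of_continuousOn hf) (memC_zero_of_continuousOn (hF N)) one_pos hc.le
    ht', add_sub_cancel_right] at h1
  have hp := Real.rpow_nonneg ht.1.le δ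
  rw [Real.dist_eq, ← mul_sub, abs_mul, abs_of_nonneg hp]
  calc t ^ δ * |rlInt c f t - rlInt c (F N) t|
      ≤ t ^ δ * (ε / (2 * K) * (Real.Gamma 1 / Real.Gamma (c + 1) * t ^ c)) :=
        mul_le_mul_of_nonneg_left h1 hp
    _ = ε / (2 * K) * (Real.Gamma 1 / Real.Gamma (c + 1) * t ^ (c + δ)) := by
        rw [Real.rpow_add ht.1]; ring
    _ ≤ ε / (2 * K) * K := by
        refine mul_le_mul_of_nonneg_left (mul_le_mul_of_nonneg_left ?_ hR0.le) (by positivity)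
        exact Real.rpow_le_rpow ht.1.le ht.2 hδ
    _ = ε / 2 := by field_simp
    _ < ε := half_lt_self hε

theorem tendstoUniformlyOn_rlInt {T c : ℝ} (hc : 0 < c)
    {F : ℕ → ℝ → ℝ} {f : ℝ → ℝ} (hF : ∀ N, ContinuousOn (F N) (Icc 0 T))
    (hf : ContinuousOn f (Icc 0 T)) (hFf : TendstoUniformlyOn F f atTop (Icc 0 T)) :
    TendstoUniformlyOn (fun N => rlInt c (F N)) (rlInt c f) atTop (Icc 0 T) := by
  have h1 := tendstoUniformlyOn_rpow_mul_rlInt (δ := 0) hc (by linarith) hF hf hFf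
  rw [Metric.tendstoUniformlyOn_iff] at h1 ⊢
  intro ε hε
  filter_upwards [h1 ε hε] with N hN t ht
  rcases ht.1.eq_or_lt with rfl | h0
  · simpa [rlInt_apply_zero hc] using hε
  · simpa using hN t ⟨h0, ht.2⟩

/-! ### The operator `A` -/

theorem A_sum {T : ℝ} {m : ℕ} {α : ℕ → ℝ} {a : ℕ → ℝ → ℝ}
    (hα : ∀ i ∈ Finset.Icc 1 m, 0 < α 0 - α i) {ι : Type*} (s : Finset ι) (r : ι → ℝ)
    {f : ι → ℝ → ℝ} (hf : ∀ k ∈ s, ContinuousOn (f k) (Icc 0 T)) {t : ℝ} (ht : t ∈ Icc 0 T) :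
    A m α a (fun x => ∑ k ∈ s, r k * f k x) t = ∑ k ∈ s, r k * A m α a (f k) t := by
  simp only [A, Finset.mul_sum]
  rw [Finset.sum_comm]
  refine Finset.sum_congr rfl fun i hi => ?_
  rw [rlInt_sum (γ := 0) s (f := fun k x => r k * f k x)
    (fun k hk => (memC_zero_of_continuousOn (hf k hk)).const_mul _) one_pos (hα i hi).le ht,
    Finset.mul_sum]
  refine Finset.sum_congr rfl fun k _ => ?_
  rw [rlInt_const_mul]; ring

theorem tendsto_A {T : ℝ} {m : ℕ} {α : ℕ → ℝ} {a : ℕ → ℝ → ℝ}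
    (hα : ∀ i ∈ Finset.Icc 1 m, 0 < α 0 - α i)
    {F : ℕ → ℝ → ℝ} {f : ℝ → ℝ} (hF : ∀ N, ContinuousOn (F N) (Icc 0 T))
    (hf : ContinuousOn f (Icc 0 T)) (hFf : TendstoUniformlyOn F f atTop (Icc 0 T))
    {t : ℝ} (ht : t ∈ Icc 0 T) :
    Tendsto (fun N => A m α a (F N) t) atTop (𝓝 (A m α a f t)) :=
  tendsto_finsetSum _ fun i hi =>
    ((tendstoUniformlyOn_rlInt (hα i hi) hF hf hFf).tendsto_at ht).const_mul _

theorem exists_pos_le {ι : Type*} (s : Finset ι) {f : ι → ℝ} (hf : ∀ i ∈ s, 0 < f i) :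
    ∃ β > 0, ∀ i ∈ s, β ≤ f i := by
  classical
  induction s using Finset.induction_on with
  | empty => exact ⟨1, one_pos, by simp⟩
  | insert i s hi ih =>
    obtain ⟨β, hβ, h⟩ := ih fun j hj => hf j (by simp [hj])
    refine ⟨min β (f i), lt_min hβ (hf i (by simp)), fun j hj => ?_⟩
    rcases Finset.mem_insert.1 hj with rfl | hj
    · exact min_le_right _ _
    · exact (min_le_left _ _).trans (h j hj)

/-- The operator `A` gains a factor `t ^ β`, with a constant that decays along the powers. -/
theorem exists_A_bound {T : ℝ} (hT : 0 < T) {m : ℕ} {α : ℕ → ℝ} {a a' : ℕ → ℝ → ℝ}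
    (hα : ∀ i ∈ Finset.Icc 1 m, 0 < α 0 - α i)
    (ha : ∀ i ∈ Finset.Icc 1 m, EulerPair T (a i) (a' i)) :
    ∃ β > 0, ∃ ρ : ℝ → ℝ, (∀ d > 0, 0 ≤ ρ d) ∧ Tendsto ρ atTop (𝓝 0) ∧
      (∀ (u : ℝ → ℝ) (d M : ℝ), 0 < d → 0 ≤ M → (∀ t ∈ Ioo 0 T, |u t| ≤ M * t ^ (d - 1)) →
        ∀ t ∈ Ioc 0 T, |A m α a u t| ≤ ρ d * M * t ^ (β + d - 1)) ∧
      (∀ (u v : ℝ → ℝ) (d M : ℝ), 0 < d → 0 ≤ M → EulerPair T u v →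
        (∀ t ∈ Ioo 0 T, |u t| ≤ M * t ^ (d - 1)) → (∀ t ∈ Ioo 0 T, |v t| ≤ M * t ^ (d - 1)) →
        ∃ v', EulerPair T (A m α a u) v' ∧
          ∀ t ∈ Ioc 0 T, |v' t| ≤ ρ d * M * t ^ (β + d - 1)) := by
  obtain ⟨β, hβ, hβα⟩ := exists_pos_le _ hα
  have hC : ∀ i ∈ Finset.Icc 1 m, ∃ C, ∀ t ∈ Icc 0 T, |a i t| ≤ C ∧ |a' i t| ≤ C := by
    intro i hi
    obtain ⟨C₁, h₁⟩ := isCompact_Icc.exists_bound_of_continuousOn (ha i hi).1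
    obtain ⟨C₂, h₂⟩ := isCompact_Icc.exists_bound_of_continuousOn (ha i hi).2
    exact ⟨max C₁ C₂, fun t ht =>
      ⟨(h₁ t ht).trans (le_max_left _ _), (h₂ t ht).trans (le_max_right _ _)⟩⟩
  choose! C hC using hC
  have hC0 : ∀ i ∈ Finset.Icc 1 m, 0 ≤ C i := fun i hi =>
    (abs_nonneg _).trans (hC i hi 0 ⟨le_rfl, hT.le⟩).1
  -- The power of `T` pays for replacing the gain `t ^ (α 0 - α i)` by the common gain `t ^ β`.
  set q : ℕ → ℝ → ℝ := fun i d =>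
    T ^ (α 0 - α i - β) * (Real.Gamma d / Real.Gamma (α 0 - α i + d)) with hq
  have hq0 : ∀ i ∈ Finset.Icc 1 m, ∀ d > 0, 0 ≤ q i d := fun i hi d hd =>
    mul_nonneg (Real.rpow_nonneg hT.le _) (div_nonneg (Real.Gamma_pos_of_pos hd).le
      (Real.Gamma_pos_of_pos (add_pos (hα i hi) hd)).le)
  have hI : ∀ i ∈ Finset.Icc 1 m, ∀ (u : ℝ → ℝ) (d M : ℝ), 0 < d → 0 ≤ M →
      (∀ t ∈ Ioo 0 T, |u t| ≤ M * t ^ (d - 1)) → ∀ t ∈ Ioc 0 T,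
      |rlInt (α 0 - α i) u t| ≤ q i d * M * t ^ (β + d - 1) := by
    intro i hi u d M hd hM hu t ht
    refine (abs_rlInt_le (hα i hi) hd ht.1 fun s hs =>
      hu s ⟨hs.1, hs.2.trans_le ht.2⟩).trans ?_
    have h1 : t ^ (α 0 - α i + d - 1) ≤ T ^ (α 0 - α i - β) * t ^ (β + d - 1) := by
      rw [show α 0 - α i + d - 1 = (α 0 - α i - β) + (β + d - 1) by ring, Real.rpow_add ht.1]
      exact mul_le_mul_of_nonneg_right
        (Real.rpow_le_rpow ht.1.le ht.2 (sub_nonneg.2 (hβα i hi))) (Real.rpow_nonneg ht.1.le _)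
    have hR : 0 ≤ Real.Gamma d / Real.Gamma (α 0 - α i + d) :=
      div_nonneg (Real.Gamma_pos_of_pos hd).le
        (Real.Gamma_pos_of_pos (add_pos (hα i hi) hd)).le
    calc _ ≤ M * (Real.Gamma d / Real.Gamma (α 0 - α i + d) *
          (T ^ (α 0 - α i - β) * t ^ (β + d - 1))) :=
        mul_le_mul_of_nonneg_left (mul_le_mul_of_nonneg_left h1 hR) hM
      _ = q i d * M * t ^ (β + d - 1) := by simp only [hq]; ring
  -- With `c = α 0 - α i`, the Euler derivative of `a i * I^c u` is `a' i * I^c u + a i * (c * I^c u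
  -- + I^c v)`; its three terms account for the factor `1 + c + 1`.
  refine ⟨β, hβ, fun d => ∑ i ∈ Finset.Icc 1 m, C i * (α 0 - α i + 2) * q i d,
    fun d hd => ?_, ?_, ?_, ?_⟩
  · exact Finset.sum_nonneg fun i hi =>
      mul_nonneg (mul_nonneg (hC0 i hi) (by linarith [hα i hi])) (hq0 i hi d hd)
  · have h1 : Tendsto (fun d => ∑ i ∈ Finset.Icc 1 m, C i * (α 0 - α i + 2) * q i d) atTop
        (𝓝 (∑ i ∈ Finset.Icc 1 m, C i * (α 0 - α i + 2) * (T ^ (α 0 - α i - β) * 0))) :=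
      tendsto_finsetSum _ fun i hi =>
        ((tendsto_Gamma_ratio (hα i hi)).const_mul _).const_mul _
    simpa using h1
  · intro u d M hd hM hu t ht
    simp only [A, Finset.sum_mul]
    refine (Finset.abs_sum_le_sum_abs _ _).trans (Finset.sum_le_sum fun i hi => ?_)
    have h1 := hI i hi u d M hd hM hu t ht
    have h2 := (hC i hi t (Ioc_subset_Icc_self ht)).1
    have h3 := (abs_nonneg _).trans h1
    have h4 := hα i hi
    rw [abs_mul]
    calc |a i t| * |rlInt (α 0 - α i) u t| ≤ C i * (q i d * M * t ^ (β + d - 1)) :=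
        mul_le_mul h2 h1 (abs_nonneg _) (hC0 i hi)
      _ ≤ (α 0 - α i + 2) * (C i * (q i d * M * t ^ (β + d - 1))) :=
        le_mul_of_one_le_left (mul_nonneg (hC0 i hi) h3) (by linarith)
      _ = _ := by ring
  · intro u v d M hd hM huv hu hv
    refine ⟨_, EulerPair.sum _ fun i hi => (ha i hi).mul (huv.rlInt hT (hα i hi)),
      fun t ht => ?_⟩
    simp only [Finset.sum_mul]
    refine (Finset.abs_sum_le_sum_abs _ _).trans (Finset.sum_le_sum fun i hi => ?_)
    have h1 := hI i hi u d M hd hM hu t ht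
    have h1' := hI i hi v d M hd hM hv t ht
    obtain ⟨h2, h2'⟩ := hC i hi t (Ioc_subset_Icc_self ht)
    have h4 := hα i hi
    set Q := q i d * M * t ^ (β + d - 1)
    have e1 : |a' i t * rlInt (α 0 - α i) u t| ≤ C i * Q := by
      rw [abs_mul]; exact mul_le_mul h2' h1 (abs_nonneg _) (hC0 i hi)
    have e2 : |(α 0 - α i) * rlInt (α 0 - α i) u t + rlInt (α 0 - α i) v t|
        ≤ (α 0 - α i) * Q + Q := by
      refine (abs_add_le _ _).trans (add_le_add ?_ h1')
      rw [abs_mul, abs_of_pos h4]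
      exact mul_le_mul_of_nonneg_left h1 h4.le
    have e3 : |a i t * ((α 0 - α i) * rlInt (α 0 - α i) u t + rlInt (α 0 - α i) v t)|
        ≤ C i * ((α 0 - α i) * Q + Q) := by
      rw [abs_mul]; exact mul_le_mul h2 e2 (abs_nonneg _) (hC0 i hi)
    refine (abs_add_le _ _).trans ((add_le_add e1 e3).trans_eq ?_)
    simp only [Q]
    ring

/-- The constants in the bounds for the iterates of `A`. -/
noncomputable def iterBound (ρ : ℝ → ℝ) (β M : ℝ) : ℕ → ℝ
  | 0 => M
  | k + 1 => ρ (k * β + 1) * iterBound ρ β M k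

theorem iterBound_nonneg {ρ : ℝ → ℝ} {β M : ℝ} (hβ : 0 < β) (hM : 0 ≤ M)
    (hρ : ∀ d > 0, 0 ≤ ρ d) (k : ℕ) : 0 ≤ iterBound ρ β M k := by
  induction k with
  | zero => exact hM
  | succ k ih => exact mul_nonneg (hρ _ (by positivity)) ih

/-- Ratio test: consecutive terms have ratio `ρ(kβ + 1) R`, which tends to `0` for every `R`. -/
theorem summable_iterBound {ρ : ℝ → ℝ} {β : ℝ} (hβ : 0 < β) (M R : ℝ)
    (hρ : Tendsto ρ atTop (𝓝 0)) : Summable fun k => iterBound ρ β M k * R ^ k := by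
  have h1 : Tendsto (fun k : ℕ => ρ (k * β + 1) * R) atTop (𝓝 (0 * R)) :=
    (hρ.comp (tendsto_atTop_add_const_right _ 1
      (tendsto_natCast_atTop_atTop.atTop_mul_const hβ))).mul_const R
  rw [zero_mul] at h1
  have h2 := h1.norm
  rw [norm_zero] at h2
  refine summable_of_ratio_norm_eventually_le (r := 1 / 2) (by norm_num) ?_
  filter_upwards [h2.eventually_le_const (u := 1 / 2) (by norm_num)] with k hk
  rw [iterBound, pow_succ, show ρ (k * β + 1) * iterBound ρ β M k * (R ^ k * R)
    = (ρ (k * β + 1) * R) * (iterBound ρ β M k * R ^ k) by ring, norm_mul]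
  exact mul_le_mul_of_nonneg_right hk (norm_nonneg _)

theorem rpow_mul_le_pow {T t β : ℝ} (hβ : 0 < β) (ht : t ∈ Ioc 0 T) (k : ℕ) :
    t ^ ((k : ℝ) * β + 1 - 1) ≤ (T ^ β) ^ k := by
  rw [add_sub_cancel_right, mul_comm, Real.rpow_mul ht.1.le, Real.rpow_natCast]
  exact pow_le_pow_left₀ (Real.rpow_nonneg ht.1.le _) (Real.rpow_le_rpow ht.1.le ht.2 hβ.le) k

/-- A bounded function dominated by its image under `A` vanishes. -/
theorem eq_zero_of_abs_le_A {T : ℝ} (hT : 0 < T) {m : ℕ} {α : ℕ → ℝ} {a a' : ℕ → ℝ → ℝ}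
    (hα : ∀ i ∈ Finset.Icc 1 m, 0 < α 0 - α i)
    (ha : ∀ i ∈ Finset.Icc 1 m, EulerPair T (a i) (a' i)) {u : ℝ → ℝ} {M : ℝ}
    (hM : ∀ t ∈ Ioo 0 T, |u t| ≤ M) (hu : ∀ t ∈ Ioo 0 T, |u t| ≤ |A m α a u t|) :
    ∀ t ∈ Ioo 0 T, u t = 0 := by
  obtain ⟨β, hβ, ρ, hρ0, hρ, hA, -⟩ := exists_A_bound hT hα ha
  have hM0 : 0 ≤ M := (abs_nonneg _).trans (hM (T / 2) ⟨half_pos hT, half_lt_self hT⟩)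
  -- Bootstrapping: each use of `hu` improves the bound by one application of `A`. The exponent `d =
  -- kβ + 1` means a power `t ^ (kβ)`, and `k = 0` is the boundedness of `u`.
  have h1 : ∀ k : ℕ, ∀ t ∈ Ioo 0 T, |u t| ≤ iterBound ρ β M k * t ^ ((k : ℝ) * β + 1 - 1) := by
    intro k
    induction k with
    | zero => intro t ht; simpa [iterBound] using hM t ht
    | succ k ih =>
      intro t ht
      refine (hu t ht).trans ((hA u _ _ (by positivity) (iterBound_nonneg hβ hM0 hρ0 k) ih t
        (Ioo_subset_Ioc_self ht)).trans_eq ?_)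
      rw [iterBound]
      congr 2
      push_cast; ring
  intro t ht
  have h2 : ∀ k, |u t| ≤ iterBound ρ β M k * (T ^ β) ^ k := fun k =>
    (h1 k t ht).trans (mul_le_mul_of_nonneg_left (rpow_mul_le_pow hβ (Ioo_subset_Ioc_self ht) k)
      (iterBound_nonneg hβ hM0 hρ0 k))
  have h3 := ge_of_tendsto' (summable_iterBound hβ M (T ^ β) hρ).tendsto_atTop_zero h2
  exact abs_nonpos_iff.1 h3

theorem abs_le_of_abs_le_Ioc {T C : ℝ} (hT : 0 < T) {u : ℝ → ℝ} (hu : ContinuousOn u (Icc 0 T))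
    (h : ∀ t ∈ Ioc 0 T, |u t| ≤ C) : ∀ t ∈ Icc 0 T, |u t| ≤ C := by
  rw [← closure_Ioc hT.ne] at hu ⊢
  exact fun t ht => le_on_closure h hu.abs continuousOn_const ht

/-- The Neumann series of `-(1 + A)⁻¹ g`. -/
theorem exists_neumann_series {T : ℝ} (hT : 0 < T) {m : ℕ} {α : ℕ → ℝ} {a a' : ℕ → ℝ → ℝ}
    (hα : ∀ i ∈ Finset.Icc 1 m, 0 < α 0 - α i)
    (ha : ∀ i ∈ Finset.Icc 1 m, EulerPair T (a i) (a' i)) {g g' : ℝ → ℝ}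
    (hg : EulerPair T g g') :
    ∃ U V : ℝ → ℝ, ∃ v : ℕ → ℝ → ℝ, EulerPair T U V ∧
      (∀ N, EulerPair T (fun t => ∑ k ∈ Finset.range N, (-1) ^ (k + 1) * (A m α a)^[k] g t)
        (v N)) ∧
      TendstoUniformlyOn (fun N t => ∑ k ∈ Finset.range N, (-1) ^ (k + 1) * (A m α a)^[k] g t) U
        atTop (Icc 0 T) ∧
      TendstoUniformlyOn v V atTop (Icc 0 T) ∧
      ∀ t ∈ Icc 0 T, U t = -g t - A m α a U t := by
  obtain ⟨β, hβ, ρ, hρ0, hρ, hA, hA'⟩ := exists_A_bound hT hα ha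
  obtain ⟨M₁, h₁⟩ := isCompact_Icc.exists_bound_of_continuousOn hg.1
  obtain ⟨M₂, h₂⟩ := isCompact_Icc.exists_bound_of_continuousOn hg.2
  set M := max M₁ M₂
  have hM0 : 0 ≤ M := (norm_nonneg _).trans ((h₁ 0 ⟨le_rfl, hT.le⟩).trans (le_max_left _ _))
  -- The iterates and their Euler derivatives are bounded by the same constants, so that both series
  -- converge uniformly.
  have hv : ∀ k : ℕ, ∃ v, EulerPair T ((A m α a)^[k] g) v ∧
      (∀ t ∈ Ioc 0 T, |(A m α a)^[k] g t| ≤ iterBound ρ β M k * t ^ ((k : ℝ) * β + 1 - 1)) ∧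
      (∀ t ∈ Ioc 0 T, |v t| ≤ iterBound ρ β M k * t ^ ((k : ℝ) * β + 1 - 1)) := by
    intro k
    induction k with
    | zero =>
      refine ⟨g', hg, fun t ht => ?_, fun t ht => ?_⟩
      · have e : |g t| ≤ M := (h₁ t (Ioc_subset_Icc_self ht)).trans (le_max_left _ _)
        simpa [iterBound] using e
      · have e : |g' t| ≤ M := (h₂ t (Ioc_subset_Icc_self ht)).trans (le_max_right _ _)
        simpa [iterBound] using e
    | succ k ih =>
      obtain ⟨v, hv, hb, hb'⟩ := ih
      have hk0 := iterBound_nonneg hβ hM0 hρ0 k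
      have hd : (0 : ℝ) < k * β + 1 := by positivity
      have hbo := fun t ht => hb t (Ioo_subset_Ioc_self ht)
      obtain ⟨v', hv', hb2⟩ := hA' _ _ _ _ hd hk0 hv hbo
        fun t ht => hb' t (Ioo_subset_Ioc_self ht)
      have e : β + ((k : ℝ) * β + 1) - 1 = ((k + 1 : ℕ) : ℝ) * β + 1 - 1 := by push_cast; ring
      refine ⟨v', ?_, fun t ht => ?_, fun t ht => ?_⟩
      · rw [Function.iterate_succ_apply']; exact hv'
      · rw [Function.iterate_succ_apply', iterBound, ← e]
        exact hA _ _ _ hd hk0 hbo t ht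
      · rw [iterBound, ← e]
        exact hb2 t ht
  choose w hw hb hb' using hv
  have hcb : ∀ k : ℕ, ∀ x : ℝ → ℝ, ContinuousOn x (Icc 0 T) →
      (∀ t ∈ Ioc 0 T, |x t| ≤ iterBound ρ β M k * t ^ ((k : ℝ) * β + 1 - 1)) →
      ∀ t ∈ Icc 0 T, ‖(-1) ^ (k + 1) * x t‖ ≤ iterBound ρ β M k * (T ^ β) ^ k := by
    intro k x hx hbx t ht
    rw [norm_mul, norm_pow, norm_neg, norm_one, one_pow, one_mul]
    exact abs_le_of_abs_le_Ioc hT hx (fun s hs => (hbx s hs).trans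
      (mul_le_mul_of_nonneg_left (rpow_mul_le_pow hβ hs k) (iterBound_nonneg hβ hM0 hρ0 k))) t ht
  have hsum := summable_iterBound hβ M (T ^ β) hρ
  have hU := tendstoUniformlyOn_tsum_nat hsum (s := Icc 0 T)
    (f := fun k t => (-1) ^ (k + 1) * (A m α a)^[k] g t)
    fun k t ht => hcb k _ (hw k).1 (hb k) t ht
  have hV := tendstoUniformlyOn_tsum_nat hsum (s := Icc 0 T)
    (f := fun k t => (-1) ^ (k + 1) * w k t) fun k t ht => hcb k _ (hw k).2 (hb' k) t ht
  have hS : ∀ N, EulerPair T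
      (fun t => ∑ k ∈ Finset.range N, (-1) ^ (k + 1) * (A m α a)^[k] g t)
      (fun t => ∑ k ∈ Finset.range N, (-1) ^ (k + 1) * w k t) := fun N =>
    EulerPair.sum _ fun k _ => (hw k).const_mul _
  have hUV := EulerPair.of_tendstoUniformlyOn hS hU hV
  refine ⟨_, _, _, hUV, hS, hU, hV, fun t ht => ?_⟩
  -- The partial sums satisfy `S_{N+1} = -g - A S_N`; the equation for `U` is the limit of this
  -- identity.
  have h3 := ((hU.tendsto_at ht).comp (tendsto_add_atTop_nat 1))
  have h4 := (tendsto_A (a := a) hα (fun N => (hS N).1) hUV.1 hU ht).const_sub (-g t)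
  refine tendsto_nhds_unique h3 (h4.congr fun N => ?_)
  rw [A_sum hα _ _ (fun k _ => (hw k).1) ht]
  simp only [Function.comp_def]
  rw [Finset.sum_range_succ', sub_eq_add_neg, ← Finset.sum_neg_distrib, add_comm]
  congr 1
  · refine Finset.sum_congr rfl fun k _ => ?_
    rw [Function.iterate_succ_apply']; ring
  · simp

/-! ### Regularity of the solutions -/

section Regularity

variable {T σ γ : ℝ} {N : ℕ} {b : ℕ → ℝ} {U V y : ℝ → ℝ}

theorem iteratedDerivWithin_of_eulerPair (hT : 0 < T) (hσ : N < σ) (hU : EulerPair T U V)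
    (hy : EqOn y (fun t => polyPart b (N + 1) 0 0 t + rlInt σ U t) (Icc 0 T)) :
    ∀ k ≤ N, EqOn (iteratedDerivWithin k y (Icc 0 T))
      (fun t => polyPart b (N + 1) k k t + rlInt (σ - k) U t) (Icc 0 T) :=
  iteratedDerivWithin_polyPart_add_rlInt hT (memC_zero_of_continuousOn hU.1) le_rfl one_pos
    (by simpa using hσ) hy

theorem hasDerivWithinAt_iteratedDerivWithin_of_eulerPair (hT : 0 < T) (hσ : N < σ)
    (hU : EulerPair T U V)
    (hy : EqOn y (fun t => polyPart b (N + 1) 0 0 t + rlInt σ U t) (Icc 0 T)) {t : ℝ}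
    (ht : t ∈ Ioc 0 T) :
    HasDerivWithinAt (iteratedDerivWithin N y (Icc 0 T))
      (((σ - N) * rlInt (σ - N) U t + rlInt (σ - N) V t) / t) (Icc 0 T) t := by
  have h1 := iteratedDerivWithin_of_eulerPair hT hσ hU hy N le_rfl
  have h2 := (hasDerivAt_polyPart_nat b (N + 1) N t).hasDerivWithinAt (s := Icc 0 T)
  have h3 := (hU.rlInt hT (sub_pos.2 hσ)).hasDerivWithinAt ht
  have h4 := h2.add h3
  rw [polyPart_of_le le_rfl, zero_add] at h4
  exact h4.congr h1 (h1 (Ioc_subset_Icc_self ht))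

/-- The last derivative of `I^σ U` is beyond the reach of lowering the order, as `σ < N + 1` is
allowed; it comes from the Euler derivative of `I^{σ-N} U` divided by `t`. The weight `γ = N + 1 -
σ` leaves `t^(-(σ-N))`, exactly compensated by the factor `t^(σ-N)` in `I^{σ-N}`. -/
theorem rpow_mul_iteratedDerivWithin_of_eulerPair (hT : 0 < T) (hσ : N < σ)
    (hγ : γ = (N + 1 : ℕ) - σ) (hU : EulerPair T U V)
    (hy : EqOn y (fun t => polyPart b (N + 1) 0 0 t + rlInt σ U t) (Icc 0 T)) {t : ℝ}
    (ht : t ∈ Ioc 0 T) :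
    t ^ γ * iteratedDerivWithin (N + 1) y (Icc 0 T) t
      = t ^ (-(σ - N)) * rlInt (σ - N) (fun s => (σ - N) * U s + V s) t := by
  have ht' := Ioc_subset_Icc_self ht
  rw [iteratedDerivWithin_succ, (hasDerivWithinAt_iteratedDerivWithin_of_eulerPair hT hσ hU hy
    ht).derivWithin (uniqueDiffOn_Icc hT t ht'),
    rlInt_add ((memC_zero_of_continuousOn hU.1).const_mul _) (memC_zero_of_continuousOn hU.2)
      one_pos (sub_pos.2 hσ).le ht', rlInt_const_mul]
  have h1 : t ^ (-(σ - N)) = t ^ γ / t := by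
    rw [← Real.rpow_sub_one ht.1.ne', hγ]
    congr 1
    push_cast; ring
  rw [h1]; ring

theorem memCn_of_eulerPair (hT : 0 < T) (hσ : N < σ) (hγ : γ = (N + 1 : ℕ) - σ)
    (hU : EulerPair T U V)
    (hy : EqOn y (fun t => polyPart b (N + 1) 0 0 t + rlInt σ U t) (Icc 0 T)) :
    MemCn T γ (N + 1) y := by
  have hc : 0 < σ - N := sub_pos.2 hσ
  have hUk := iteratedDerivWithin_of_eulerPair hT hσ hU hy
  have hU0 := memC_zero_of_continuousOn hU.1
  refine ⟨contDiffOn_of_continuousOn_differentiableOn_deriv (fun k hk => ?_) (fun k hk t ht => ?_),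
    fun t ht => (hasDerivWithinAt_iteratedDerivWithin_of_eulerPair hT hσ hU hy
      ht).differentiableWithinAt, ?_⟩
  · have hk' : k ≤ N := by exact_mod_cast hk
    have hkR : (k : ℝ) ≤ N := by exact_mod_cast hk'
    exact ((continuous_polyPart le_rfl).continuousOn.add (hU0.continuousOn_rlInt hT.le one_pos
      (by linarith) (by linarith))).congr (hUk k hk')
  · have hk' : k + 1 ≤ N := by exact_mod_cast hk
    have hkR : (k : ℝ) + 1 ≤ N := by exact_mod_cast hk'
    have h2 := hasDerivWithinAt_rlInt_Icc (c := σ - k - 1) hT hU0 one_pos (by linarith)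
      (by linarith) ht
    rw [sub_add_cancel] at h2
    exact (((hasDerivAt_polyPart_nat b (N + 1) k t).hasDerivWithinAt.add
      h2).differentiableWithinAt).congr (hUk k (by omega)) (hUk k (by omega) ht)
  · obtain ⟨u, hu, huf⟩ := ((hU0.const_mul (σ - N)).add
      (memC_zero_of_continuousOn hU.2)).exists_rlInt_eq hT.le one_pos hc
    refine ⟨u, hu.continuousOn, fun t ht => ?_⟩
    rw [rpow_mul_iteratedDerivWithin_of_eulerPair hT hσ hγ hU hy ht, huf t ht, ← mul_assoc,
      ← Real.rpow_add ht.1]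
    simp

theorem tendstoCn_of_eulerPair (hT : 0 < T) (hσ : N < σ) (hγ : γ = (N + 1 : ℕ) - σ)
    {Us Vs ys : ℕ → ℝ → ℝ} (hUs : ∀ M, EulerPair T (Us M) (Vs M)) (hU : EulerPair T U V)
    (hUU : TendstoUniformlyOn Us U atTop (Icc 0 T))
    (hVV : TendstoUniformlyOn Vs V atTop (Icc 0 T))
    (hys : ∀ M, EqOn (ys M) (fun t => polyPart b (N + 1) 0 0 t + rlInt σ (Us M) t) (Icc 0 T))
    (hy : EqOn y (fun t => polyPart b (N + 1) 0 0 t + rlInt σ U t) (Icc 0 T)) :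
    TendstoCn T γ (N + 1) ys y := by
  have hc : 0 < σ - N := sub_pos.2 hσ
  refine ⟨fun M => memCn_of_eulerPair hT hσ hγ (hUs M) (hys M), memCn_of_eulerPair hT hσ hγ hU hy,
    fun k hk => ?_, ?_⟩
  · have hkR : (k : ℝ) ≤ N := by exact_mod_cast Nat.lt_succ_iff.1 hk
    have h1 := tendstoUniformlyOn_rlInt (c := σ - k) (by linarith) (fun M => (hUs M).1) hU.1 hUU
    rw [Metric.tendstoUniformlyOn_iff] at h1 ⊢
    intro ε hε
    filter_upwards [h1 ε hε] with M hM t ht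
    rw [iteratedDerivWithin_of_eulerPair hT hσ (hUs M) (hys M) k (Nat.lt_succ_iff.1 hk) ht,
      iteratedDerivWithin_of_eulerPair hT hσ hU hy k (Nat.lt_succ_iff.1 hk) ht, dist_add_left]
    exact hM t ht
  · have h0 : TendstoUniformlyOn (fun M s => (σ - N) * Us M s + Vs M s)
        (fun s => (σ - N) * U s + V s) atTop (Icc 0 T) := by
      rw [Metric.tendstoUniformlyOn_iff] at hUU hVV ⊢
      intro ε hε
      filter_upwards [hUU (ε / 2 / (σ - N)) (by positivity), hVV (ε / 2) (half_pos hε)]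
        with M h1 h2 t ht
      have e1 := h1 t ht
      have e2 := h2 t ht
      rw [Real.dist_eq] at e1 e2 ⊢
      rw [lt_div_iff₀ hc] at e1
      rw [show (σ - N) * U t + V t - ((σ - N) * Us M t + Vs M t)
        = (σ - N) * (U t - Us M t) + (V t - Vs M t) by ring]
      refine (abs_add_le _ _).trans_lt ?_
      rw [abs_mul, abs_of_pos hc]
      linarith
    have h1 := tendstoUniformlyOn_rpow_mul_rlInt (c := σ - N) (δ := -(σ - N)) hc (by linarith)
      (fun M => ((hUs M).1.const_smul (σ - N)).add (hUs M).2)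
      ((hU.1.const_smul (σ - N)).add hU.2) h0
    refine (h1.congr (Eventually.of_forall fun M t ht => ?_)).congr_right fun t ht => ?_
    · exact (rpow_mul_iteratedDerivWithin_of_eulerPair hT hσ hγ (hUs M) (hys M) ht).symm
    · exact (rpow_mul_iteratedDerivWithin_of_eulerPair hT hσ hγ hU hy ht).symm

end Regularity

theorem MemCn.tendsto_iteratedDerivWithin {T γ : ℝ} {N k : ℕ} {y : ℝ → ℝ} (hT : 0 < T)
    (hy : MemCn T γ (N + 1) y) (hk : k < N + 1) :
    Tendsto (iteratedDerivWithin k y (Icc 0 T)) (𝓝[>] 0)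
      (𝓝 (iteratedDerivWithin k y (Icc 0 T) 0)) :=
  (hy.1.continuousOn_iteratedDerivWithin (by exact_mod_cast Nat.lt_succ_iff.1 hk)
    (uniqueDiffOn_Icc hT) 0 ⟨le_rfl, hT.le⟩).mono_left (nhdsWithin_le_of_mem (Icc_mem_nhdsGT hT))

/-! ### Existence -/

/-- The contribution of the initial data `b 0, …, b (n - 1)` to the Volterra equation satisfied by
the Caputo derivative of highest order of a solution. -/
noncomputable def forcing (m : ℕ) (α : ℕ → ℝ) (a : ℕ → ℝ → ℝ) (n : ℕ) (b : ℕ → ℝ) (t : ℝ) : ℝ :=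
  ∑ i ∈ Finset.Icc 1 m, a i t * polyPart b n ⌈α i⌉₊ (α i) t

theorem exists_eulerPair_forcing {T : ℝ} {m : ℕ} {α : ℕ → ℝ} {a a' : ℕ → ℝ → ℝ}
    (ha : ∀ i ∈ Finset.Icc 1 m, EulerPair T (a i) (a' i)) (n : ℕ) (b : ℕ → ℝ) :
    ∃ g', EulerPair T (forcing m α a n b) g' :=
  ⟨_, EulerPair.sum _ fun i hi => (ha i hi).mul (EulerPair.sum _ fun _ hj =>
    (EulerPair.Phi (one_le_of_mem_Ico (Nat.le_ceil (α i)) hj)).const_mul _)⟩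

/-- Here `U` is the Caputo derivative of order `α 0` of `y`; substituting the formulas for the lower
derivatives turns the Volterra equation back into the differential one. -/
theorem solvesEq_of_volterra {T : ℝ} {m N : ℕ} {α : ℕ → ℝ} {a : ℕ → ℝ → ℝ} {b : ℕ → ℝ}
    {U V y : ℝ → ℝ} (hT : 0 < T) (hα : ∀ i ∈ Finset.Icc 1 m, 0 < α 0 - α i)
    (hα0 : ∀ i ≤ m, 0 ≤ α i) (hN : ⌈α 0⌉₊ = N + 1) (hσ : N < α 0) (hU : EulerPair T U V)
    (hUA : ∀ t ∈ Ioo 0 T, U t = -forcing m α a (N + 1) b t - A m α a U t)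
    (hy : EqOn y (fun t => polyPart b (N + 1) 0 0 t + rlInt (α 0) U t) (Icc 0 T)) :
    SolvesEq T m α a y ∧ InitialConditions T (fun k : Fin (N + 1) => b k) y := by
  have hder0 : ∀ k < N + 1, iteratedDerivWithin k y (Icc 0 T) 0 = b k := by
    intro k hk
    have hkR : (k : ℝ) ≤ N := by exact_mod_cast Nat.lt_succ_iff.1 hk
    rw [iteratedDerivWithin_of_eulerPair hT hσ hU hy k (Nat.lt_succ_iff.1 hk) ⟨le_rfl, hT.le⟩]
    simp only
    rw [polyPart_nat_apply_zero hk, rlInt_apply_zero (by linarith), add_zero]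
  have hαle : ∀ i ≤ m, α i ≤ α 0 := by
    intro i hi
    rcases Nat.eq_zero_or_pos i with rfl | h0
    · exact le_rfl
    · exact (sub_pos.1 (hα i (Finset.mem_Icc.2 ⟨h0, hi⟩))).le
  have hcap : ∀ i ≤ m, ∀ t ∈ Ioc 0 T, CaputoExistsAt T (α i) y t ∧
      caputo T (α i) y t = rlInt (α 0 - α i) U t + polyPart b (N + 1) ⌈α i⌉₊ (α i) t := by
    intro i hi
    have hle : ⌈α i⌉₊ ≤ N + 1 := hN ▸ Nat.ceil_mono (hαle i hi)
    exact caputo_polyPart_add_rlInt hT (memC_zero_of_continuousOn hU.1) one_pos (hαle i hi)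
      (hα0 i hi) hle (hy.mono Ioc_subset_Icc_self) fun k hk => hder0 k (hk.trans_le hle)
  refine ⟨fun t ht => ⟨fun i hi => (hcap i hi t (Ioo_subset_Ioc_self ht)).1, ?_⟩, fun k => ?_⟩
  · rw [(hcap 0 (Nat.zero_le _) t (Ioo_subset_Ioc_self ht)).2, sub_self, rlInt_zero_left,
      polyPart_of_le hN.ge, add_zero, hUA t ht, forcing, A, ← neg_add', ← Finset.sum_add_distrib]
    refine congrArg _ (Finset.sum_congr rfl fun i hi => ?_)
    rw [(hcap i (Finset.mem_Icc.1 hi).2 t (Ioo_subset_Ioc_self ht)).2]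
    ring
  · have h1 := (memCn_of_eulerPair hT hσ rfl hU hy).tendsto_iteratedDerivWithin hT k.2
    rwa [hder0 k k.2] at h1

/-! ### Uniqueness -/

theorem caputo_of_memCn {T γ β : ℝ} {N : ℕ} {z : ℝ → ℝ} (hT : 0 < T) (hγ : γ < 1)
    (hz : MemCn T γ (N + 1) z) (hβ0 : 0 ≤ β) (hβ : β ≤ (N + 1 : ℕ)) {t : ℝ} (ht : t ∈ Ioc 0 T) :
    caputo T β z t = rlInt ((N + 1 : ℕ) - β) (iteratedDerivWithin (N + 1) z (Icc 0 T)) t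
      + polyPart (fun j => iteratedDerivWithin j z (Icc 0 T) 0) (N + 1) ⌈β⌉₊ β t :=
  (caputo_polyPart_add_rlInt hT hz.2.2 hγ hβ hβ0 (Nat.ceil_le.2 hβ)
    ((eqOn_taylor hT hγ hz).mono Ioc_subset_Icc_self) (fun _ _ => rfl) t ht).2

theorem polyPart_congr {b b' : ℕ → ℝ} {n : ℕ} (h : ∀ k < n, b k = b' k) (p : ℕ) (α t : ℝ) :
    polyPart b n p α t = polyPart b' n p α t :=
  Finset.sum_congr rfl fun j hj => by rw [h j (Finset.mem_Ico.1 hj).2]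

/-- The difference of the highest Caputo derivatives solves the homogeneous Volterra equation, and
it is bounded although the `(N+1)`-th derivatives may be unbounded at `0`. -/
theorem eqOn_of_solvesEq {T γ : ℝ} {m N : ℕ} {α : ℕ → ℝ} {a a' : ℕ → ℝ → ℝ} (hT : 0 < T)
    (hα : ∀ i ∈ Finset.Icc 1 m, 0 < α 0 - α i) (hα0 : ∀ i ≤ m, 0 ≤ α i)
    (hN : ⌈α 0⌉₊ = N + 1) (hγ : γ = (N + 1 : ℕ) - α 0) (hγ1 : γ < 1)
    (ha : ∀ i ∈ Finset.Icc 1 m, EulerPair T (a i) (a' i)) {z₁ z₂ : ℝ → ℝ}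
    (h₁ : MemCn T γ (N + 1) z₁) (h₂ : MemCn T γ (N + 1) z₂) (e₁ : SolvesEq T m α a z₁)
    (e₂ : SolvesEq T m α a z₂) {b : Fin (N + 1) → ℝ} (i₁ : InitialConditions T b z₁)
    (i₂ : InitialConditions T b z₂) : EqOn z₁ z₂ (Icc 0 T) := by
  have hα0N : α 0 ≤ (N + 1 : ℕ) := hN ▸ Nat.le_ceil (α 0)
  have hγ0 : 0 ≤ γ := by linarith
  have hαN : ∀ i ∈ Finset.Icc 1 m, α i ≤ (N + 1 : ℕ) := fun i hi => by linarith [hα i hi]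
  set w₁ := iteratedDerivWithin (N + 1) z₁ (Icc 0 T) with hw₁
  set w₂ := iteratedDerivWithin (N + 1) z₂ (Icc 0 T) with hw₂
  have hb : ∀ k < N + 1, iteratedDerivWithin k z₁ (Icc 0 T) 0
      = iteratedDerivWithin k z₂ (Icc 0 T) 0 := fun k hk =>
    (tendsto_nhds_unique (h₁.tendsto_iteratedDerivWithin hT hk) (i₁ ⟨k, hk⟩)).trans
      (tendsto_nhds_unique (h₂.tendsto_iteratedDerivWithin hT hk) (i₂ ⟨k, hk⟩)).symm
  have hW : MemC T γ (fun t => w₁ t - w₂ t) := by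
    simpa only [neg_one_mul, ← sub_eq_add_neg] using h₁.2.2.add (h₂.2.2.const_mul (-1))
  -- Since `γ = N + 1 - α 0`, this is the difference of the two Caputo derivatives of order `α 0`;
  -- the integration of order `γ` just absorbs the singularity `t^(-γ)`.
  set d := rlInt γ (fun t => w₁ t - w₂ t) with hd
  have hd0 : MemC T 0 d := hW.rlInt hT.le hγ1 hγ0 (sub_self γ).le
  have hsub : ∀ c ≥ 0, ∀ t ∈ Icc 0 T,
      rlInt c (fun t => w₁ t - w₂ t) t = rlInt c w₁ t - rlInt c w₂ t := fun c hc t ht =>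
    rlInt_sub h₁.2.2 h₂.2.2 hγ1 hc ht
  have hdA : ∀ t ∈ Ioo 0 T, d t = -A m α a d t := by
    intro t ht
    have htc := Ioo_subset_Ioc_self ht
    have htI := Ioo_subset_Icc_self ht
    have q₁ := (e₁ t ht).2
    have q₂ := (e₂ t ht).2
    rw [caputo_of_memCn hT hγ1 h₁ (hα0 0 (Nat.zero_le _)) hα0N htc, polyPart_of_le hN.ge,
      add_zero, ← hγ] at q₁
    rw [caputo_of_memCn hT hγ1 h₂ (hα0 0 (Nat.zero_le _)) hα0N htc, polyPart_of_le hN.ge,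
      add_zero, ← hγ] at q₂
    rw [hd, hsub γ hγ0 t htI, q₁, q₂, ← neg_sub', ← Finset.sum_sub_distrib, A]
    refine congrArg _ (Finset.sum_congr rfl fun i hi => ?_)
    have hi' := (Finset.mem_Icc.1 hi).2
    rw [caputo_of_memCn hT hγ1 h₁ (hα0 i hi') (hαN i hi) htc,
      caputo_of_memCn hT hγ1 h₂ (hα0 i hi') (hαN i hi) htc, polyPart_congr hb,
      rlInt_rlInt hT hW hγ1 (hα i hi).le hγ0 htc,
      show α 0 - α i + γ = (N + 1 : ℕ) - α i by rw [hγ]; ring,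
      hsub _ (sub_nonneg.2 (hαN i hi)) t htI]
    ring
  obtain ⟨M, -, hM⟩ := hd0.exists_bound hT.le
  have hdz : ∀ t ∈ Ioo 0 T, d t = 0 := eq_zero_of_abs_le_A hT hα ha (M := M)
    (fun t ht => by simpa using hM t (Ioo_subset_Ioc_self ht))
    (fun t ht => by rw [hdA t ht, abs_neg])
  have hIoo : EqOn z₁ z₂ (Ioo 0 T) := by
    intro t ht
    have htI := Ioo_subset_Icc_self ht
    have hN0 : (0 : ℝ) ≤ (N + 1 : ℕ) - γ := by
      have : (0 : ℝ) ≤ N := Nat.cast_nonneg N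
      push_cast; linarith
    have s1 := rlInt_rlInt hT hW hγ1 hN0 hγ0 (Ioo_subset_Ioc_self ht)
    -- Apply `I^{N+1-γ}` to `d = I^γ (w₁ - w₂) = 0`. The zero function is written `0 * 0` so that
    -- `rlInt_const_mul` evaluates its integral.
    rw [sub_add_cancel, hsub _ (Nat.cast_nonneg _) t htI, ← hd,
      rlInt_congr hN0 ht.1 (g := fun _ => 0 * 0)
        (fun s hs => by simpa using hdz s ⟨hs.1, hs.2.trans_lt ht.2⟩),
      rlInt_const_mul, zero_mul] at s1
    rw [eqOn_taylor hT hγ1 h₁ htI, eqOn_taylor hT hγ1 h₂ htI]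
    simp only
    rw [polyPart_congr hb, sub_eq_zero.1 s1.symm]
  exact hIoo.of_subset_closure h₁.1.continuousOn h₂.1.continuousOn Ioo_subset_Icc_self
    (closure_Ioo hT.ne).ge

/-! ### The canonical fundamental system -/

theorem polyPart_single {n j : ℕ} (hj : j < n) (p : ℕ) (α t : ℝ) :
    polyPart (Pi.single j 1) n p α t = if p ≤ j then Phi (j + 1 - α) t else 0 := by
  unfold polyPart
  simp only [Pi.single_apply, ite_mul, one_mul, zero_mul, Finset.sum_ite_eq', Finset.mem_Ico, hj,
    and_true]

theorem polyPart_eq_sum_single {n : ℕ} (b : Fin n → ℝ) (p : ℕ) (α t : ℝ) :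
    polyPart (fun k => if hk : k < n then b ⟨k, hk⟩ else 0) n p α t
      = ∑ j : Fin n, b j * polyPart (Pi.single (j : ℕ) 1) n p α t := by
  have h1 : ∀ j : Fin n, b j * polyPart (Pi.single (j : ℕ) 1) n p α t
      = b j * if p ≤ (j : ℕ) then Phi ((j : ℕ) + 1 - α) t else 0 := fun j => by
    rw [polyPart_single j.2]
  rw [Finset.sum_congr rfl fun j _ => h1 j, Finset.sum_fin_eq_sum_range, polyPart]
  have h2 : Finset.Ico p n = (Finset.range n).filter (p ≤ ·) := by
    ext k; simp [and_comm]
  rw [h2, Finset.sum_filter]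
  refine Finset.sum_congr rfl fun k hk => ?_
  rw [dif_pos (Finset.mem_range.1 hk), dif_pos (Finset.mem_range.1 hk)]
  split_ifs <;> simp

theorem forcing_eq_sum_single {m n : ℕ} {α : ℕ → ℝ} {a : ℕ → ℝ → ℝ} (b : Fin n → ℝ) (t : ℝ) :
    forcing m α a n (fun k => if hk : k < n then b ⟨k, hk⟩ else 0) t
      = ∑ j : Fin n, b j * forcing m α a n (Pi.single (j : ℕ) 1) t := by
  simp only [forcing, Finset.mul_sum]
  rw [Finset.sum_comm]
  refine Finset.sum_congr rfl fun i _ => ?_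
  rw [polyPart_eq_sum_single, Finset.mul_sum]
  exact Finset.sum_congr rfl fun j _ => by ring

theorem forcing_single {m n j : ℕ} {α : ℕ → ℝ} {a : ℕ → ℝ → ℝ} (hj : j < n) (t : ℝ) :
    forcing m α a n (Pi.single j 1) t
      = ∑ i ∈ (Finset.Icc 1 m).filter (fun i => α i ≤ j), a i t * Phi (j + 1 - α i) t := by
  rw [forcing, Finset.sum_filter]
  refine Finset.sum_congr rfl fun i _ => ?_
  rw [polyPart_single hj]
  simp only [Nat.ceil_le, mul_ite, mul_zero]

/-- The orders decrease with the index, so the condition `α i ≤ j` selects a final segment of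
indices, and `h_j` is its first element. -/
theorem forcing_single_eq_G {m n j : ℕ} {α : ℕ → ℝ} {a : ℕ → ℝ → ℝ}
    (hα : StrictAntiOn α (Iic m)) (hj : j < n) (hH : (H m α j).Nonempty) :
    forcing m α a n (Pi.single j 1) = G m α a j := by
  funext t
  rw [forcing_single hj, G]
  refine Finset.sum_congr (Finset.ext fun i => ?_) fun _ _ => rfl
  obtain ⟨h1, h2, h3, h4⟩ : h m α j ∈ H m α j := Nat.sInf_mem hH
  simp only [Finset.mem_filter, Finset.mem_Icc]
  constructor
  · rintro ⟨⟨hi1, him⟩, hij⟩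
    have hi0 : 0 ≤ α i ∨ α i < 0 := le_or_gt _ _
    refine ⟨?_, him⟩
    by_contra! hlt
    rcases hi0 with hi0 | hi0
    · exact absurd (Nat.sInf_le (show i ∈ H m α j from ⟨hi1, him, hi0, hij⟩)) (not_le.2 hlt)
    · exact absurd (hα (show i ∈ Iic m from him) (show h m α j ∈ Iic m from h2) hlt)
        (not_lt.2 (hi0.le.trans h3))
  · rintro ⟨hi, him⟩
    exact ⟨⟨h1.trans hi, him⟩,
      (hα.antitoneOn (show h m α j ∈ Iic m from h2) (show i ∈ Iic m from him) hi).trans h4⟩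

theorem forcing_single_eq_zero {m n j : ℕ} {α : ℕ → ℝ} {a : ℕ → ℝ → ℝ} (hα0 : ∀ i ≤ m, 0 ≤ α i)
    (hj : j < n) (hH : H m α j = ∅) (t : ℝ) : forcing m α a n (Pi.single j 1) t = 0 := by
  rw [forcing_single hj]
  refine Finset.sum_eq_zero fun i hi => ?_
  simp only [Finset.mem_filter, Finset.mem_Icc] at hi
  have : i ∈ H m α j := ⟨hi.1.1, hi.1.2, hα0 i hi.1.2, hi.2⟩
  rw [hH] at this
  exact absurd this (notMem_empty i)

theorem H_mono {m j k : ℕ} {α : ℕ → ℝ} (hjk : j ≤ k) : H m α j ⊆ H m α k :=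
  fun _ ⟨h1, h2, h3, h4⟩ => ⟨h1, h2, h3, h4.trans (by exact_mod_cast hjk)⟩

theorem polyPart_single_zero {n j : ℕ} (hj : j < n) (t : ℝ) :
    polyPart (Pi.single j 1) n 0 0 t = Phi (j + 1) t := by
  rw [polyPart_single hj, if_pos (Nat.zero_le j), sub_zero]

theorem continuousOn_iterate_A {T : ℝ} (hT : 0 < T) {m : ℕ} {α : ℕ → ℝ} {a a' : ℕ → ℝ → ℝ}
    (hα : ∀ i ∈ Finset.Icc 1 m, 0 < α 0 - α i)
    (ha : ∀ i ∈ Finset.Icc 1 m, EulerPair T (a i) (a' i)) {g : ℝ → ℝ}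
    (hg : ContinuousOn g (Icc 0 T)) (k : ℕ) : ContinuousOn ((A m α a)^[k] g) (Icc 0 T) := by
  induction k with
  | zero => exact hg
  | succ k ih =>
    rw [Function.iterate_succ_apply']
    exact continuousOn_finsetSum _ fun i hi => (ha i hi).1.mul
      ((memC_zero_of_continuousOn ih).continuousOn_rlInt hT.le one_pos (hα i hi) (hα i hi))

theorem partialSum_eqOn {T : ℝ} {m j n M : ℕ} {α : ℕ → ℝ} {a : ℕ → ℝ → ℝ} (hj : j < n)
    (hα : 0 ≤ α 0) (hA : ∀ k, ContinuousOn ((A m α a)^[k] (G m α a j)) (Icc 0 T)) :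
    EqOn (partialSum m α a j M) (fun t => polyPart (Pi.single j 1) n 0 0 t
      + rlInt (α 0) (fun t => ∑ k ∈ Finset.range M, (-1) ^ (k + 1) * (A m α a)^[k] (G m α a j) t) t)
      (Icc 0 T) := by
  intro t ht
  beta_reduce
  rw [partialSum, ← polyPart_single_zero hj, rlInt_sum (γ := 0) _
    (f := fun k t => (-1) ^ (k + 1) * (A m α a)^[k] (G m α a j) t)
    (fun k _ => (memC_zero_of_continuousOn (hA k)).const_mul _) one_pos hα ht]
  simp only [rlInt_const_mul]

end CaputoFDE

/-! ### The main theorem -/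

theorem corollary3 (T : ℝ) (hT : 0 < T) (m : ℕ)
    -- the orders `α 0 > α 1 > ⋯ > α m ≥ 0` and the integers `n i` with `n i - 1 < α i ≤ n i`
    (α : ℕ → ℝ) (n : ℕ → ℕ)
    (hα : StrictAntiOn α (Set.Iic m)) (hα0 : ∀ i ≤ m, 0 ≤ α i)
    (hn : ∀ i ≤ m, (n i : ℝ) - 1 < α i ∧ α i ≤ n i)
    (γ : ℝ) (hγ : γ = n 0 - α 0) (hγ0 : 0 < γ) (hγ1 : γ < 1)
    (hn01 : n 0 = n 1)
    -- the coefficients: `a i ∈ C_γ^1[0, T]` and `D_{0+}^{n 0 - α 0} (a i) ∈ C[0, T]`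
    (a : ℕ → ℝ → ℝ)
    (ha : ∀ i ∈ Finset.Icc 1 m, MemCn T γ 1 (a i))
    (haD : ∀ i ∈ Finset.Icc 1 m,
      (∀ t ∈ Set.Ioc 0 T, RlDerivExistsAt T (n 0 - α 0) (a i) t) ∧
      MemC T 0 (rlDeriv T (n 0 - α 0) (a i)))
    -- the equation is of type II
    (j₀ : ℕ) (hj₀ : j₀ + 2 ≤ n 0)
    (hH : H m α j₀ = ∅) (hH' : (H m α (j₀ + 1)).Nonempty) :
    ∃ y : Fin (n 0) → ℝ → ℝ,
      -- `y` is the unique canonical fundamental system in `C_γ^{n 0}[0, T]`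
      (∀ j, MemCn T γ (n 0) (y j)) ∧
      IsCanonicalFundamentalSystem T m α a y ∧
      (∀ w : Fin (n 0) → ℝ → ℝ, (∀ j, MemCn T γ (n 0) (w j)) →
        IsCanonicalFundamentalSystem T m α a w → ∀ j, Set.EqOn (w j) (y j) (Set.Icc 0 T)) ∧
      -- its explicit form
      (∀ j : Fin (n 0), (j : ℕ) ≤ j₀ → ∀ t ∈ Set.Icc 0 T, y j t = Phi ((j : ℕ) + 1) t) ∧
      (∀ j : Fin (n 0), j₀ + 1 ≤ (j : ℕ) → TendstoCn T γ (n 0) (partialSum m α a j) (y j)) ∧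
      -- the initial value problem has the unique solution `∑ j, b j * y j`
      ∀ b : Fin (n 0) → ℝ,
        (MemCn T γ (n 0) (fun t => ∑ j, b j * y j t) ∧
          SolvesEq T m α a (fun t => ∑ j, b j * y j t) ∧
          InitialConditions T b (fun t => ∑ j, b j * y j t)) ∧
        ∀ z : ℝ → ℝ, MemCn T γ (n 0) z → SolvesEq T m α a z → InitialConditions T b z →
          Set.EqOn z (fun t => ∑ j, b j * y j t) (Set.Icc 0 T) := by
  have hσ : (n 0 : ℝ) - 1 < α 0 := (hn 0 (Nat.zero_le m)).1
  have hσ' : α 0 ≤ n 0 := (hn 0 (Nat.zero_le m)).2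
  -- The number `n 0` occurs in the types `Fin (n 0)`; it has to become a variable before `N + 1`
  -- can be substituted.
  generalize n 0 = p at *
  obtain ⟨N, rfl⟩ : ∃ N, p = N + 1 := ⟨p - 1, by omega⟩
  have hσN : (N : ℝ) < α 0 := by push_cast at hσ; linarith
  have hceil : ⌈α 0⌉₊ = N + 1 :=
    le_antisymm (Nat.ceil_le.2 hσ') (Nat.succ_le_of_lt (Nat.lt_ceil.2 hσN))
  have hα00 : 0 ≤ α 0 := hα0 0 (Nat.zero_le m)
  have hβ : ∀ i ∈ Finset.Icc 1 m, 0 < α 0 - α i := fun i hi => by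
    obtain ⟨h1, h2⟩ := Finset.mem_Icc.1 hi
    exact sub_pos.2 (hα (show 0 ∈ Set.Iic m from Nat.zero_le m) (show i ∈ Set.Iic m from h2) h1)
  have ha' : ∀ i ∈ Finset.Icc 1 m, ∃ a', EulerPair T (a i) a' := fun i hi =>
    EulerPair.of_memCn hγ1 (ha i hi)
  choose! a' ha' using ha'
  have hser : ∀ j : Fin (N + 1), _ := fun j =>
    exists_neumann_series hT hβ ha'
      (exists_eulerPair_forcing (α := α) ha' (N + 1) (Pi.single (j : ℕ) 1)).choose_spec
  choose U V v hUV hS hU hV hUA using hser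
  let y : Fin (N + 1) → ℝ → ℝ := fun j t => Phi ((j : ℕ) + 1) t + rlInt (α 0) (U j) t
  have hy : ∀ j, Set.EqOn (y j)
      (fun t => polyPart (Pi.single (j : ℕ) 1) (N + 1) 0 0 t + rlInt (α 0) (U j) t)
      (Set.Icc 0 T) := fun j t _ => by
    simp only [y]
    rw [polyPart_single_zero j.2]
  have hyC : ∀ j, MemCn T γ (N + 1) (y j) := fun j =>
    memCn_of_eulerPair hT hσN hγ (hUV j) (hy j)
  have hsys : IsCanonicalFundamentalSystem T m α a y := fun j => by
    obtain ⟨h1, h2⟩ := solvesEq_of_volterra hT hβ hα0 hceil hσN (hUV j)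
      (fun t ht => hUA j t (Set.Ioo_subset_Icc_self ht)) (hy j)
    refine ⟨h1, fun k => ?_⟩
    have h3 := h2 k
    simp only [Pi.single_apply] at h3
    simpa only [Fin.ext_iff, eq_comm (a := (j : ℕ))] using h3
  refine ⟨y, hyC, hsys, fun w hw hw' j => ?_, fun j hj t ht => ?_, fun j hj => ?_, fun b => ?_⟩
  · exact eqOn_of_solvesEq hT hβ hα0 hceil hγ hγ1 ha' (hw j) (hyC j) (hw' j).1 (hsys j).1
      (hw' j).2 (hsys j).2
  · have hH0 : H m α j = ∅ := Set.subset_empty_iff.1 (hH ▸ H_mono hj)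
    -- As `H_j` is empty the forcing vanishes, so `U j = -A (U j)` and `U j` is zero: only `Φ_{j+1}`
    -- remains.
    have hz := eq_zero_of_abs_le_A hT hβ ha' (u := U j)
      (fun t ht => (isCompact_Icc.exists_bound_of_continuousOn (hUV j).1).choose_spec t
        (Set.Ioo_subset_Icc_self ht))
      (fun t ht => by
        rw [hUA j t (Set.Ioo_subset_Icc_self ht), forcing_single_eq_zero hα0 j.2 hH0, neg_zero,
          zero_sub, abs_neg])
    have hz' : Set.EqOn (U j) (fun _ => 0) (Set.Icc 0 T) :=
      Set.EqOn.of_subset_closure hz (hUV j).1 continuousOn_const Set.Ioo_subset_Icc_self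
        (closure_Ioo hT.ne).ge
    have h1 : rlInt (α 0) (U j) t = 0 := by
      rw [rlInt_congr_Icc (g := fun _ => 0 * 0) ((Nat.cast_nonneg N).trans_lt hσN)
        (fun s hs => by simpa using hz' (Set.Ioc_subset_Icc_self hs)) ht, rlInt_const_mul, zero_mul]
    simp only [y, h1, add_zero]
  · have hG : forcing m α a (N + 1) (Pi.single (j : ℕ) 1) = G m α a j :=
      forcing_single_eq_G hα j.2 (hH'.mono (H_mono hj))
    have hS' := hS j
    have hU' := hU j
    have hc := (exists_eulerPair_forcing (α := α) ha' (N + 1) (Pi.single (j : ℕ) 1)).choose_spec.1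
    rw [hG] at hS' hU' hc
    exact tendstoCn_of_eulerPair hT hσN hγ hS' (hUV j) hU' (hV j)
      (fun M => partialSum_eqOn j.2 hα00 (continuousOn_iterate_A hT hβ ha' hc)) (hy j)
  · set b' : ℕ → ℝ := fun k => if hk : k < N + 1 then b ⟨k, hk⟩ else 0 with hb'
    have hUVb : EulerPair T (fun t => ∑ j, b j * U j t) (fun t => ∑ j, b j * V j t) :=
      EulerPair.sum _ fun j _ => (hUV j).const_mul (b j)
    have hyb : Set.EqOn (fun t => ∑ j, b j * y j t) (fun t => polyPart b' (N + 1) 0 0 t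
        + rlInt (α 0) (fun t => ∑ j, b j * U j t) t) (Set.Icc 0 T) := fun t ht => by
      beta_reduce
      rw [hb', polyPart_eq_sum_single, rlInt_sum (γ := 0) _ (f := fun j t => b j * U j t)
        (fun j _ => (memC_zero_of_continuousOn (hUV j).1).const_mul _) one_pos hα00 ht,
        ← Finset.sum_add_distrib]
      refine Finset.sum_congr rfl fun j _ => ?_
      rw [hy j ht, rlInt_const_mul, mul_add]
    have hbC := memCn_of_eulerPair hT hσN hγ hUVb hyb
    obtain ⟨hsol, hini⟩ := solvesEq_of_volterra (a := a) hT hβ hα0 hceil hσN hUVb (fun t ht => by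
      have htI := Set.Ioo_subset_Icc_self ht
      rw [hb', forcing_eq_sum_single, A_sum hβ _ _ (fun j _ => (hUV j).1) htI,
        ← Finset.sum_neg_distrib, ← Finset.sum_sub_distrib]
      refine Finset.sum_congr rfl fun j _ => ?_
      rw [hUA j t htI]; ring) hyb
    have hini' : InitialConditions T b (fun t => ∑ j, b j * y j t) := fun k => by
      have h3 := hini k
      simp only [hb', k.2, dif_pos] at h3
      exact h3
    exact ⟨⟨hbC, hsol, hini'⟩, fun z hz hz' hz'' =>
      eqOn_of_solvesEq hT hβ hα0 hceil hγ hγ1 ha' hz hbC hz' hsol hz'' hini'⟩
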